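/- Let $\mathbb{F}$ be a field, let $n\ge 1$ be an integer with prime factorization $n=p_1^{a_1}\cdots p_k^{a_k}$ for distinct primes $p_1,\dots,p_k$ and exponents $a_i\ge 1$, and let $P$ be the finite ranked poset of positive divisors of $n$, ordered by divisibility. The splitting algebra $A(P)$ over $\mathbb{F}$ is defined as follows. Let $E_P=\{(q,p)\in P\times P : q \text{ covers } p\}$ be the set of edges of the Hasse diagram; the edge $(q,p)$ has tail $q$ and head $p$. A path is a nonempty tuple of edges $\pi=(e_1,\dots,e_m)$ such that the head of $e_i$ is the tail of $e_{i+1}$ for $1\le i<m$; its tail is the tail of $e_1$ and its head is the head of $e_m$. Put $(t-e_1)(t-e_2)\cdots(t-e_m)=\sum_{i\ge 0}e(\pi,i)t^i$ in $\mathbb{F}\langle E_P\rangle[t]$, where $\mathbb{F}\langle E_P\rangle$ is the free algebra on $E_P$ and $t$ is central. Then $A(P)$ is the quotient of $\mathbb{F}\langle E_P\rangle$ by the two-sided ideal generated by all $e(\pi_1,i)-e(\pi_2,i)$ with $i\ge 0$ and $\pi_1,\pi_2$ paths with the same tail and the same head. It is graded by $A(P)=\bigoplus_{i\ge0}A(P)_i$,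 where $A(P)_i$ is the span of the products of $i$ edges. Let $\sigma$ be a permutation of $\{p_1,\dots,p_k\}$ such that $p$ and $\sigma(p)$ have the same multiplicity in $n$ for every $p$. It induces the automorphism $\prod_i p_i^{b_i}\mapsto\prod_i\sigma(p_i)^{b_i}$ of the poset $P$, and hence a graded automorphism of $A(P)$, which sends the edge $(q,p)$ to the edge $(\sigma(q),\sigma(p))$; both are again denoted by $\sigma$. Let $\sigma_1,\dots,\sigma_r$ be the cycles of $\sigma$ as a permutation of $\{p_1,\dots,p_k\}$, with each fixed point counted as a cycle of length $1$; let $i_j$ be the length of $\sigma_j$ and let $s_j$ be the common multiplicity in $n$ of the primes in $\sigma_j$. Then the graded trace generating function $Tr_\sigma(A(P),z)=\sum_{i\ge0}Tr\left(\sigma|_{A(P)_i}\right)z^i$ satisfies, in $\mathbb{F}[[z]]$, \[Tr_\sigma(A(P),z)=\frac{1-z}{1-z\prod_{j=1}^r\left(1+s_j\left(1-z^{i_j}\right)\right)}.\] -/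

import Mathlib

/-! ## The splitting algebra of a poset -/

namespace SplittingAlg

universe u v

/-- An edge of the Hasse diagram of `P`: an ordered pair `(tail, head)` such that `tail` covers
`head`. Edges point downwards. -/
@[ext]
structure HasseEdge (P : Type v) [PartialOrder P] where
  tail : P
  head : P
  covBy : head ⋖ tail

/-- A path in the Hasse diagram: a nonempty tuple of edges `(e₁, …, eₘ)` such that the head of each
edge is the tail of the next one. -/
structure HassePath (P : Type v) [PartialOrder P] where
  edges : List (HasseEdge P)
  ne_nil : edges ≠ []
  isChain : edges.IsChain (fun e f => e.head = f.tail)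

section

variable {P : Type v} [PartialOrder P]

/-- The tail of a path is the tail of its first edge. -/
def HassePath.tail (π : HassePath P) : P := (π.edges.head π.ne_nil).tail

/-- The head of a path is the head of its last edge. -/
def HassePath.head (π : HassePath P) : P := (π.edges.getLast π.ne_nil).head

/-- The action of an order automorphism on the edges of the Hasse diagram. -/
def HasseEdge.map (σ : P ≃o P) (e : HasseEdge P) : HasseEdge P where
  tail := σ e.tail
  head := σ e.head
  covBy := (apply_covBy_apply_iff σ).2 e.covBy

/-- The action of an order automorphism on the paths of the Hasse diagram. -/
def HassePath.map (σ : P ≃o P) (π : HassePath P) : HassePath P where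
  edges := π.edges.map (HasseEdge.map σ)
  ne_nil := by simpa using π.ne_nil
  isChain := by
    rw [List.isChain_map]
    exact π.isChain.imp (fun e f h => congrArg σ h)

theorem HassePath.tail_map (σ : P ≃o P) (π : HassePath P) : (π.map σ).tail = σ π.tail := by
  simp [HassePath.tail, HassePath.map, HasseEdge.map]

theorem HassePath.head_map (σ : P ≃o P) (π : HassePath P) : (π.map σ).head = σ π.head := by
  simp [HassePath.head, HassePath.map, HasseEdge.map]

end

section

variable (F : Type u) [Field F] {P : Type v} [PartialOrder P]

/-- The polynomial `(t - e₁)(t - e₂)⋯(t - eₘ)` in a central variable `t`, with coefficients in the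
free algebra on the edges. -/
noncomputable def HassePath.poly (π : HassePath P) : Polynomial (FreeAlgebra F (HasseEdge P)) :=
  (π.edges.map fun e => Polynomial.X - Polynomial.C (FreeAlgebra.ι F e)).prod

variable (P)

/-- The defining relations of the splitting algebra: equally indexed coefficients of the polynomials
of two paths with the same tail and the same head are identified. -/
inductive SplittingRel : FreeAlgebra F (HasseEdge P) → FreeAlgebra F (HasseEdge P) → Prop
  | coeff (π₁ π₂ : HassePath P) (htail : π₁.tail = π₂.tail) (hhead : π₁.head = π₂.head) (i : ℕ) :
      SplittingRel ((π₁.poly F).coeff i) ((π₂.poly F).coeff i)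

/-- The splitting algebra `A(P)`: the free algebra on the edges of the Hasse diagram modulo the
two-sided ideal generated by the differences of related elements. -/
abbrev SplittingAlgebra : Type (max u v) := RingQuot (SplittingRel F P)

variable {P}

/-- The class in `A(P)` of an edge. -/
noncomputable def edgeClass (e : HasseEdge P) : SplittingAlgebra F P :=
  RingQuot.mkAlgHom F (SplittingRel F P) (FreeAlgebra.ι F e)

variable (P)

/-- The graded piece `A(P)_i`: the span of the products of exactly `i` edges, that is, the image of
the degree `i` part of the free algebra. -/
noncomputable def gradedPiece (i : ℕ) : Submodule F (SplittingAlgebra F P) :=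
  Submodule.span F (Set.range (edgeClass F (P := P))) ^ i

variable {P}

/-- The algebra map of free algebras that an order automorphism induces. -/
noncomputable def freeMap (σ : P ≃o P) :
    FreeAlgebra F (HasseEdge P) →ₐ[F] FreeAlgebra F (HasseEdge P) :=
  FreeAlgebra.lift F (fun e => FreeAlgebra.ι F (e.map σ))

theorem freeMap_coeff_poly (σ : P ≃o P) (π : HassePath P) (i : ℕ) :
    freeMap F σ ((π.poly F).coeff i) = ((π.map σ).poly F).coeff i := by
  have h : (π.poly F).map (freeMap F σ).toRingHom = (π.map σ).poly F := by
    unfold HassePath.poly HassePath.map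
    rw [← Polynomial.coe_mapRingHom, map_list_prod, List.map_map, List.map_map]
    congr 1
    apply List.map_congr_left
    intro e _
    simp [freeMap]
  rw [← h, Polynomial.coeff_map]
  rfl

/-- The endomorphism `σ` of `A(P)` induced by an order automorphism `σ` of `P`; it sends the class
of the edge `(q, p)` to the class of `(σ q, σ p)`. -/
noncomputable def inducedMap (σ : P ≃o P) : SplittingAlgebra F P →ₐ[F] SplittingAlgebra F P :=
  RingQuot.liftAlgHom F ⟨(RingQuot.mkAlgHom F (SplittingRel F P)).comp (freeMap F σ), by
    rintro _ _ ⟨π₁, π₂, ht, hh, i⟩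
    simp only [AlgHom.comp_apply, freeMap_coeff_poly]
    apply RingQuot.mkAlgHom_rel
    apply SplittingRel.coeff
    · rw [HassePath.tail_map, HassePath.tail_map, ht]
    · rw [HassePath.head_map, HassePath.head_map, hh]⟩

theorem inducedMap_edgeClass (σ : P ≃o P) (e : HasseEdge P) :
    inducedMap F σ (edgeClass F e) = edgeClass F (e.map σ) := by
  simp [inducedMap, edgeClass, freeMap]

theorem inducedMap_mem_gradedPiece (σ : P ≃o P) (i : ℕ) :
    ∀ x ∈ gradedPiece F P i, (inducedMap F σ).toLinearMap x ∈ gradedPiece F P i := by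
  have h1 : (Submodule.span F (Set.range (edgeClass F (P := P)))).map
      (inducedMap F σ).toLinearMap ≤ Submodule.span F (Set.range (edgeClass F (P := P))) := by
    rw [Submodule.map_span_le]
    rintro _ ⟨e, rfl⟩
    rw [AlgHom.toLinearMap_apply, inducedMap_edgeClass]
    exact Submodule.subset_span ⟨_, rfl⟩
  intro x hx
  have h2 := Submodule.mem_map_of_mem (f := (inducedMap F σ).toLinearMap) hx
  unfold gradedPiece at h2 ⊢
  rw [Submodule.map_pow] at h2
  exact pow_le_pow_left' h1 i h2

/-- The graded trace generating function
`Tr_σ(A(P), z) = ∑ i, Tr(σ restricted to A(P)_i) z ^ i`. -/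
noncomputable def gradedTrace (σ : P ≃o P) : PowerSeries F :=
  PowerSeries.mk fun i => LinearMap.trace F (gradedPiece F P i)
    ((inducedMap F σ).toLinearMap.restrict (inducedMap_mem_gradedPiece F σ i))

end

/-! ## The poset of factors of `n` -/

/-- The set of factors of `n`. -/
@[ext]
structure FactorPoset (n : ℕ) where
  val : ℕ
  dvd : val ∣ n

/-- Factors are ordered by divisibility. -/
instance (n : ℕ) : PartialOrder (FactorPoset n) where
  le a b := a.val ∣ b.val
  le_refl a := dvd_refl a.val
  le_trans _ _ _ := dvd_trans
  le_antisymm _ _ hab hba := FactorPoset.ext (Nat.dvd_antisymm hab hba)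

/-- The type of prime divisors of `n`. -/
abbrev PrimeDivisor (n : ℕ) : Type := {p : ℕ // p ∈ n.primeFactors}

section

variable {n : ℕ}

/-- The natural number `∏ p, τ(p) ^ (multiplicity of p in d)`. -/
def shuffleNat (τ : Equiv.Perm (PrimeDivisor n)) (d : ℕ) : ℕ :=
  ∏ p : PrimeDivisor n, ((τ p : PrimeDivisor n) : ℕ) ^ d.factorization p

theorem shuffleNat_ne_zero (τ : Equiv.Perm (PrimeDivisor n)) (d : ℕ) : shuffleNat τ d ≠ 0 :=
  Finset.prod_ne_zero_iff.2 fun p _ => pow_ne_zero _ (Nat.prime_of_mem_primeFactors (τ p).2).ne_zero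

theorem factorization_shuffleNat (τ : Equiv.Perm (PrimeDivisor n)) (d : ℕ) (q : PrimeDivisor n) :
    (shuffleNat τ d).factorization (τ q) = d.factorization q := by
  unfold shuffleNat
  rw [Nat.factorization_prod fun p _ =>
    pow_ne_zero _ (Nat.prime_of_mem_primeFactors (τ p).2).ne_zero]
  rw [Finsupp.finsetSum_apply, Finset.sum_eq_single q]
  · rw [(Nat.prime_of_mem_primeFactors (τ q).2).factorization_pow, Finsupp.single_eq_same]
  · intro p _ hp
    rw [(Nat.prime_of_mem_primeFactors (τ p).2).factorization_pow, Finsupp.single_eq_of_ne]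
    intro h
    exact hp (τ.injective (Subtype.ext h.symm))
  · simp

theorem factorization_shuffleNat_of_notMem (τ : Equiv.Perm (PrimeDivisor n)) (d q : ℕ)
    (hq : q ∉ n.primeFactors) : (shuffleNat τ d).factorization q = 0 := by
  unfold shuffleNat
  rw [Nat.factorization_prod fun p _ =>
    pow_ne_zero _ (Nat.prime_of_mem_primeFactors (τ p).2).ne_zero]
  rw [Finsupp.finsetSum_apply]
  apply Finset.sum_eq_zero
  intro p _
  rw [(Nat.prime_of_mem_primeFactors (τ p).2).factorization_pow, Finsupp.single_eq_of_ne]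
  rintro rfl
  exact hq (τ p).2

theorem shuffleNat_dvd_iff (τ : Equiv.Perm (PrimeDivisor n)) (d e : ℕ) :
    shuffleNat τ d ∣ shuffleNat τ e ↔
      ∀ q : PrimeDivisor n, d.factorization q ≤ e.factorization q := by
  rw [← Nat.factorization_le_iff_dvd (shuffleNat_ne_zero τ d) (shuffleNat_ne_zero τ e)]
  constructor
  · intro h q
    rw [← factorization_shuffleNat τ d, ← factorization_shuffleNat τ e]
    exact h _
  · intro h q
    by_cases hq : q ∈ n.primeFactors
    · have h3 := h (τ.symm ⟨q, hq⟩)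
      rw [← factorization_shuffleNat τ d, ← factorization_shuffleNat τ e] at h3
      simpa using h3
    · rw [factorization_shuffleNat_of_notMem τ d q hq]
      exact Nat.zero_le _

theorem factorization_eq_zero_of_dvd (hn : n ≠ 0) {d q : ℕ} (hd : d ∣ n)
    (hq : q ∉ n.primeFactors) : d.factorization q = 0 := by
  have h := (Nat.factorization_le_iff_dvd (ne_zero_of_dvd_ne_zero hn hd) hn).2 hd q
  have h0 : n.factorization q = 0 := by
    rw [← Nat.support_factorization] at hq
    exact Finsupp.notMem_support_iff.1 hq
  omega

theorem shuffleNat_dvd (hn : n ≠ 0) (τ : Equiv.Perm (PrimeDivisor n))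
    (hτ : ∀ p, n.factorization (τ p) = n.factorization p) {d : ℕ} (hd : d ∣ n) :
    shuffleNat τ d ∣ n := by
  rw [← Nat.factorization_le_iff_dvd (shuffleNat_ne_zero τ d) hn]
  intro q
  by_cases hq : q ∈ n.primeFactors
  · obtain ⟨p, hp⟩ := τ.surjective ⟨q, hq⟩
    have hpq : ((τ p : PrimeDivisor n) : ℕ) = q := by rw [hp]
    rw [← hpq, factorization_shuffleNat, hτ p]
    exact (Nat.factorization_le_iff_dvd (ne_zero_of_dvd_ne_zero hn hd) hn).2 hd p
  · rw [factorization_shuffleNat_of_notMem τ d q hq]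
    exact Nat.zero_le _

theorem shuffleNat_symm (hn : n ≠ 0) (τ : Equiv.Perm (PrimeDivisor n)) {d : ℕ} (hd : d ∣ n) :
    shuffleNat τ.symm (shuffleNat τ d) = d := by
  apply Nat.eq_of_factorization_eq (shuffleNat_ne_zero _ _) (ne_zero_of_dvd_ne_zero hn hd)
  intro q
  by_cases hq : q ∈ n.primeFactors
  · have h1 := factorization_shuffleNat τ.symm (shuffleNat τ d) (τ ⟨q, hq⟩)
    rw [Equiv.symm_apply_apply, factorization_shuffleNat] at h1
    exact h1
  · rw [factorization_shuffleNat_of_notMem _ _ q hq, factorization_eq_zero_of_dvd hn hd hq]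

/-- The automorphism of the poset of factors of `n` that sends `∏ p, p ^ (a p)` to
`∏ p, τ(p) ^ (a p)`, where `τ` permutes prime divisors of `n` of equal multiplicity. -/
def primeShuffle (hn : n ≠ 0) (τ : Equiv.Perm (PrimeDivisor n))
    (hτ : ∀ p, n.factorization (τ p) = n.factorization p) : FactorPoset n ≃o FactorPoset n where
  toFun d := ⟨shuffleNat τ d.val, shuffleNat_dvd hn τ hτ d.dvd⟩
  invFun d := ⟨shuffleNat τ.symm d.val, shuffleNat_dvd hn τ.symm
    (fun p => by rw [← hτ (τ.symm p), Equiv.apply_symm_apply]) d.dvd⟩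
  left_inv d := FactorPoset.ext (shuffleNat_symm hn τ d.dvd)
  right_inv d := FactorPoset.ext (shuffleNat_symm hn τ.symm d.dvd)
  map_rel_iff' := by
    intro a b
    change shuffleNat τ a.val ∣ shuffleNat τ b.val ↔ a.val ∣ b.val
    rw [shuffleNat_dvd_iff, ← Nat.factorization_le_iff_dvd (ne_zero_of_dvd_ne_zero hn a.dvd)
      (ne_zero_of_dvd_ne_zero hn b.dvd)]
    constructor
    · intro h q
      by_cases hq : q ∈ n.primeFactors
      · exact h ⟨q, hq⟩
      · rw [factorization_eq_zero_of_dvd hn a.dvd hq]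
        exact Nat.zero_le _
    · intro h q
      exact h q

/-- The cycles of a permutation `τ` of the prime divisors of `n`, that is, the orbits of `τ`. Fixed
points count as cycles of length one. -/
abbrev PrimeCycle (τ : Equiv.Perm (PrimeDivisor n)) : Type :=
  Quotient (Equiv.Perm.SameCycle.setoid τ)

noncomputable instance (τ : Equiv.Perm (PrimeDivisor n)) : Fintype (PrimeCycle τ) :=
  Fintype.ofFinite _

/-- The length of a cycle: the number of primes that it moves around. -/
noncomputable def cycleLength (τ : Equiv.Perm (PrimeDivisor n)) (c : PrimeCycle τ) : ℕ :=
  Nat.card {p : PrimeDivisor n // Quotient.mk (Equiv.Perm.SameCycle.setoid τ) p = c}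

/-- The common multiplicity in `n` of the primes in a cycle. -/
def cycleMult (τ : Equiv.Perm (PrimeDivisor n))
    (hτ : ∀ p, n.factorization (τ p) = n.factorization p) (c : PrimeCycle τ) : ℕ :=
  Quotient.lift (s := Equiv.Perm.SameCycle.setoid τ) (fun p : PrimeDivisor n => n.factorization p)
    (by
      intro p q hpq
      obtain ⟨k, -, -, hk⟩ := Equiv.Perm.SameCycle.exists_pow_eq τ hpq
      have h : ∀ m : ℕ, n.factorization ((τ ^ m) p : PrimeDivisor n) = n.factorization p := by
        intro m
        induction m with
        | zero => rfl
        | succ m ih => rw [pow_succ', Equiv.Perm.mul_apply, hτ, ih]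
      change n.factorization p = n.factorization q
      rw [← hk, h]) c

end

end SplittingAlg

/-! Each vertex $v$ carries the polynomial of any path from $v$ to the least element. Its
coefficients $a(v,k)$, in descending order, satisfy $a(v,k+1)=a(y,k+1)+(a(v,1)-a(y,1))\,a(y,k)$
whenever $v$ covers $y$, and the edge $(v,y)$ is $a(y,1)-a(v,1)$. The proof rests on a basis of
$A(P)$ permuted by $\sigma$: the products of letters $a(v,k)$, $1\le k\le \mathrm{rk}\,v$, in which
$(v,k)$ is never followed by a letter of some $u<v$ of rank $\mathrm{rk}\,v-k$.

Spanning (`normalSpan_le_sup`, `controlled`): for $y,y'$ covered by $v$, the product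
$a(v,1)(a(y,1)-a(y',1))$ only involves ranks below $v$. So $a(v,1)$ need only be applied to
representatives modulo such differences, and these it turns into normal words. Independence
(`linearIndependent_wval`): a module is built rank by rank (`PathRep.exists_step`), in which the
operators of each new rank satisfy only the forced relations. Comparing leading ranks there shows
that no combination of normal words vanishes (`indepMod_succ`).

Hence the trace on $A(P)_i$ is the number of fixed normal words of degree $i$ (`coeff_gradedTrace`).
Sorting these by first letter gives a triangular linear system over the fixed vertices. If $\gamma$
vanishes off the fixed vertices and $\sum_{u\le v}z^{\mathrm{rk}\,v-\mathrm{rk}\,u}\gamma(u)=1$ at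
each fixed $v$, then the trace series is $(1-z)/(1-z\sum_v\gamma(v))$ (`gradedTrace_eq`). The fixed
divisors form a product of chains, one per cycle, and $\gamma$ is a product over the cycles: the
factor is $1$ at exponent $0$ and $1-z^{i_j}$ at each of the $s_j$ other exponents. Summing gives
$\prod_j(1+s_j(1-z^{i_j}))$. -/

namespace SplittingAlg

universe u v w

/-! ### Ranked posets with the diamond property -/

/-- A rank function on a poset with a unique element of rank zero, such that any two elements
covered by a common element cover a common element. -/
structure IsUniformRank {P : Type v} [PartialOrder P] (rk : P → ℕ) : Prop where
  strictMono : StrictMono rk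
  covBy : ∀ {x y : P}, x ⋖ y → rk y = rk x + 1
  unique_zero : ∀ {x y : P}, rk x = 0 → rk y = 0 → x = y
  exists_covBy : ∀ {y : P}, rk y ≠ 0 → ∃ x, x ⋖ y
  diamond : ∀ {x x' y : P}, x ⋖ y → x' ⋖ y → x ≠ x' → ∃ z, z ⋖ x ∧ z ⋖ x'

namespace IsUniformRank

variable {P : Type v} [PartialOrder P] {rk : P → ℕ}

theorem covBy_of_le (hrk : IsUniformRank rk) {x y : P} (h : x ≤ y) (h' : rk y = rk x + 1) : x ⋖ y := by
  refine ⟨lt_of_le_of_ne h (by rintro rfl; omega), fun z h1 h2 => ?_⟩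
  have := hrk.strictMono h1
  have := hrk.strictMono h2
  omega

/-- Below every element there are elements of every smaller rank. -/
theorem exists_le_rank (hrk : IsUniformRank rk) (v : P) (r : ℕ) (h : r ≤ rk v) : ∃ t ≤ v, rk t = r := by
  induction hn : rk v using Nat.strong_induction_on generalizing v with
  | _ n ih =>
    subst hn
    rcases h.eq_or_lt with h | h
    · exact ⟨v, le_rfl, h.symm⟩
    · obtain ⟨x, hx⟩ := hrk.exists_covBy (y := v) (by omega)
      have h1 := hrk.covBy hx
      obtain ⟨t, ht, ht'⟩ := ih (rk x) (by omega) x (by omega) rfl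
      exact ⟨t, ht.trans hx.le, ht'⟩

/-- Elements of equal rank below `v` are connected through common covers below `v`. -/
theorem connected [Finite P] (hrk : IsUniformRank rk) (E : P → P → Prop) (htrans : ∀ x y z, E x y → E y z → E x z)
    (v : P) (hE : ∀ s ≤ v, ∀ t t', t ⋖ s → t' ⋖ s → E t t') :
    ∀ t t', t ≤ v → t' ≤ v → rk t = rk t' → rk t < rk v → E t t' := by
  induction hn : rk v using Nat.strong_induction_on generalizing v with
  | _ n ih =>
    subst hn
    intro t t' ht ht' h h'
    obtain ⟨u, htu, hu⟩ := exists_le_covBy_of_lt (ht.lt_of_ne (by rintro rfl; omega))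
    obtain ⟨u', htu', hu'⟩ := exists_le_covBy_of_lt (ht'.lt_of_ne (by rintro rfl; omega))
    have h1 := hrk.covBy hu
    have h2 := hrk.covBy hu'
    by_cases h3 : rk t + 1 = rk v
    · exact hE v le_rfl t t' (hrk.covBy_of_le ht (by omega)) (hrk.covBy_of_le ht' (by omega))
    · by_cases h4 : u = u'
      · subst h4
        exact ih (rk u) (by omega) u (fun s hs => hE s (hs.trans hu.le)) rfl t t' htu htu' h
          (by omega)
      -- An element `s` of rank `rk t` below the common lower cover `z` is joined to `t` below `u`
      -- and to `t'` below `u'`.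
      · obtain ⟨z, hz, hz'⟩ := hrk.diamond hu hu' h4
        have h5 := hrk.covBy hz
        obtain ⟨s, hs, hs'⟩ := hrk.exists_le_rank z (rk t) (by omega)
        refine htrans t s t' ?_ ?_
        · exact ih (rk u) (by omega) u (fun s hs => hE s (hs.trans hu.le)) rfl t s htu
            (hs.trans hz.le) (by omega) (by omega)
        · exact ih (rk u') (by omega) u' (fun s hs => hE s (hs.trans hu'.le)) rfl s t'
            (hs.trans hz'.le) htu' (by omega) (by omega)

end IsUniformRank

/-! ### Spans of differences of operators -/

section DiffSpan

variable {F : Type u} [Field F] {P : Type v} {V : Type w} [AddCommGroup V] [Module F V]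

variable (F V) in
/-- Families of vectors that are supported on `S` and have sum zero. -/
def zeroSum [Fintype P] (S : Set P) : Submodule F (P → V) where
  carrier := {c | (∀ y, y ∉ S → c y = 0) ∧ ∑ y, c y = 0}
  add_mem' := by
    rintro a b ⟨h1, h2⟩ ⟨h3, h4⟩
    exact ⟨fun y hy => by simp [h1 y hy, h3 y hy], by simp [Finset.sum_add_distrib, h2, h4]⟩
  zero_mem' := ⟨fun y _ => rfl, by simp⟩
  smul_mem' := by
    rintro r a ⟨h1, h2⟩
    exact ⟨fun y hy => by simp [h1 y hy], by simp [← Finset.smul_sum, h2]⟩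

/-- The map that sends a family `c` to `∑ y, X y (c y)`. -/
def sumMap [Fintype P] (X : P → Module.End F V) : (P → V) →ₗ[F] V :=
  ∑ y, X y ∘ₗ LinearMap.proj y

theorem sumMap_apply [Fintype P] (X : P → Module.End F V) (c : P → V) :
    sumMap X c = ∑ y, X y (c y) := by
  simp [sumMap]

/-- The span of the images of the differences `X y - X y'` for `y`, `y'` in `S`. -/
def diffSpan [Fintype P] (X : P → Module.End F V) (S : Set P) : Submodule F V :=
  (zeroSum F V S).map (sumMap X)

theorem mem_diffSpan [Fintype P] {X : P → Module.End F V} {S : Set P} {x : V} :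
    x ∈ diffSpan X S ↔ ∃ c : P → V, (∀ y, y ∉ S → c y = 0) ∧ ∑ y, c y = 0 ∧
      ∑ y, X y (c y) = x := by
  simp only [diffSpan, Submodule.mem_map, sumMap_apply]
  exact ⟨fun ⟨c, ⟨h1, h2⟩, h3⟩ => ⟨c, h1, h2, h3⟩, fun ⟨c, h1, h2, h3⟩ => ⟨c, ⟨h1, h2⟩, h3⟩⟩

theorem diffSpan_mono [Fintype P] {X : P → Module.End F V} {S T : Set P} (h : S ⊆ T) :
    diffSpan X S ≤ diffSpan X T := by
  intro x hx
  obtain ⟨c, h1, h2, h3⟩ := mem_diffSpan.1 hx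
  exact mem_diffSpan.2 ⟨c, fun y hy => h1 y (fun h' => hy (h h')), h2, h3⟩

/-- A linear map factors through another one if its kernel is larger; the factorization
may be chosen so that its range does not grow. -/
theorem exists_factor {K W W' : Type*} [AddCommGroup K] [Module F K] [AddCommGroup W] [Module F W]
    [AddCommGroup W'] [Module F W'] (f : K →ₗ[F] W) (h : K →ₗ[F] W')
    (hker : ∀ x, f x = 0 → h x = 0) :
    ∃ s : W →ₗ[F] K, ∀ x, h (s (f x)) = h x := by
  -- A section of `f` over its range, extended to all of `W`; `s (f x)` and `x` then differ by an
  -- element of the kernel of `f`.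
  obtain ⟨r, hr⟩ := f.rangeRestrict.exists_rightInverse_of_surjective f.range_rangeRestrict
  obtain ⟨s, hs⟩ := LinearMap.exists_extend r
  refine ⟨s, fun x => ?_⟩
  have h1 : f (s (f x)) = f x := by
    have h2 : s (f x) = r (f.rangeRestrict x) := by rw [← hs]; rfl
    rw [h2]
    exact congrArg Subtype.val (LinearMap.congr_fun hr (f.rangeRestrict x))
  rw [← sub_eq_zero, ← map_sub]
  apply hker
  rw [map_sub, h1, sub_self]

/-- Every subspace is the kernel of an endomorphism. -/
theorem exists_end_ker (J : Submodule F V) : ∃ p : Module.End F V, ∀ x, p x = 0 ↔ x ∈ J := by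
  obtain ⟨q, hq⟩ := Submodule.exists_isCompl J
  refine ⟨q.subtype ∘ₗ q.projectionOnto J hq.symm, fun x => ?_⟩
  simp

end DiffSpan

end SplittingAlg

/-! ### Representations of the relations up to a given rank -/

namespace SplittingAlg

universe u v w

open Finset

/-- Operators `g x k` on a space `V`, to be thought of as the coefficients of the inverse of the
polynomial of a path from `x` to the least element, satisfying the relations between the elements
of rank at most `m`, and as independent as these relations permit. -/
structure PathRep (F : Type u) [Field F] {P : Type v} [PartialOrder P] [Fintype P] (rk : P → ℕ)
    (m : ℕ) (V : Type w) [AddCommGroup V] [Module F V] where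
  g : P → ℕ → Module.End F V
  one : V
  lam : V →ₗ[F] F
  g_zero : ∀ x, g x 0 = 1
  g_bot : ∀ x, rk x = 0 → ∀ k, g x (k + 1) = 0
  g_covBy : ∀ x y, x ⋖ y → rk y ≤ m → ∀ k,
    g y (k + 1) = g x (k + 1) + g y k * (g y 1 - g x 1)
  lam_one : lam one = 1
  lam_g_one : ∀ x, rk x ≤ m → ∀ a, lam (g x 1 a) = 0
  -- For `y`, `y'` covered by `x`, the case `k = 1` of `g_covBy` forces `g x 1 * (g y 1 - g y' 1) =
  -- g y 2 - g y' 2`, which is expressible in lower rank. This field says that no other relations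
  -- hold in leading rank.
  leading : ∀ r, 1 ≤ r → r ≤ m → ∀ d : P → V, (∀ x, r < rk x → d x = 0) →
    ∑ x, g x 1 (d x) = 0 → ∀ x, rk x = r → d x ∈ diffSpan (fun y => g y 1) {y | y ⋖ x}

namespace PathRep

variable {F : Type u} [Field F] {P : Type v} [PartialOrder P] [Fintype P] {rk : P → ℕ} {m : ℕ}
  {V : Type w} [AddCommGroup V] [Module F V]

theorem lam_g (hrk : IsUniformRank rk) (R : PathRep F rk m V) (x : P) (hx : rk x ≤ m) (k : ℕ)
    (a : V) : R.lam (R.g x (k + 1) a) = 0 := by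
  induction hn : rk x using Nat.strong_induction_on generalizing x k a with
  | _ n ih =>
    subst hn
    induction k generalizing a with
    | zero => exact R.lam_g_one x hx a
    | succ k ihk =>
      by_cases h0 : rk x = 0
      · rw [R.g_bot x h0]; simp
      · obtain ⟨y, hy⟩ := hrk.exists_covBy h0
        have h1 := hrk.covBy hy
        rw [R.g_covBy y x hy hx]
        simp only [LinearMap.add_apply, Module.End.mul_apply, map_add]
        rw [ih (rk y) (by omega) y (by omega) (k + 1) a rfl, ihk, add_zero]

/-- Applying `g y k` to an element of the span of differences below `y`. -/
theorem g_sum (R : PathRep F rk m V) {y : P} (hy : rk y ≤ m) {c : P → V}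
    (hc : ∀ x, x ∉ {x | x ⋖ y} → c x = 0) (hs : ∑ x, c x = 0) (k : ℕ) :
    R.g y k (∑ x, R.g x 1 (c x)) = ∑ x, R.g x (k + 1) (c x) := by
  -- By `g_covBy`, the subtracted operator does not depend on `x`, so it disappears after summation
  -- because `c` has sum zero.
  have h : ∀ x, R.g y k (R.g x 1 (c x)) =
      R.g x (k + 1) (c x) - (R.g y (k + 1) - R.g y k * R.g y 1) (c x) := by
    intro x
    by_cases hx : x ⋖ y
    · rw [R.g_covBy x y hx hy k]
      simp only [LinearMap.add_apply, LinearMap.sub_apply, Module.End.mul_apply, map_sub]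
      abel
    · rw [hc x hx]; simp
  rw [map_sum, Finset.sum_congr rfl fun x _ => h x, Finset.sum_sub_distrib, ← map_sum, hs]
  simp

/-- If the first two coefficients of `∑ x, G x (d x)` vanish, with `x` of rank `r`, then all do. -/
theorem sum_g_eq_zero (hrk : IsUniformRank rk) (R : PathRep F rk m V) (r : ℕ) (hr : r ≤ m)
    (d : P → V) (hd : ∀ x, rk x ≠ r → d x = 0) (h0 : ∑ x, d x = 0)
    (h1 : ∑ x, R.g x 1 (d x) = 0) (k : ℕ) : ∑ x, R.g x k (d x) = 0 := by
  induction r generalizing d k with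
  | zero =>
    apply Finset.sum_eq_zero
    intro x _
    by_cases hx : rk x = 0
    · rw [Finset.sum_eq_single x] at h0
      · rw [h0, map_zero]
      · intro y _ hy
        exact hd y fun h => hy (hrk.unique_zero h hx)
      · simp
    · rw [hd x hx, map_zero]
  | succ r ih =>
    -- By `leading` each `d x` is itself a combination of differences one rank lower, so the sum can
    -- be rewritten with coefficients of index `k + 1` in rank `r`.
    have h2 : ∀ x, ∃ c : P → V, (∀ y, y ∉ {y | y ⋖ x} → c y = 0) ∧ ∑ y, c y = 0 ∧
        ∑ y, R.g y 1 (c y) = d x := by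
      intro x
      by_cases hx : rk x = r + 1
      · exact mem_diffSpan.1 (R.leading (r + 1) (by omega) hr d (fun x h => hd x (by omega))
          h1 x hx)
      · exact ⟨0, by simp, by simp, by simp [hd x hx]⟩
    choose c hc hc0 hc1 using h2
    have hcr : ∀ x y, rk y ≠ r → rk x ≤ m → rk x = r + 1 → c x y = 0 := by
      intro x y hy _ hx
      refine hc x y fun h => hy ?_
      have := hrk.covBy h
      omega
    set c' : P → P → V := fun x y => if rk x = r + 1 then c x y else 0 with hc'
    have hd' : ∀ x, d x = ∑ y, R.g y 1 (c' x y) := by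
      intro x
      by_cases hx : rk x = r + 1
      · simp [hc', hx, hc1]
      · simp [hc', hx, hd x hx]
    have key : ∀ k, ∑ x, R.g x k (d x) = ∑ y, R.g y (k + 1) (∑ x, c' x y) := by
      intro k
      simp_rw [map_sum]
      rw [Finset.sum_comm]
      refine Finset.sum_congr rfl fun x _ => ?_
      by_cases hx : rk x = r + 1
      · simp only [hc', hx, if_true]
        rw [← R.g_sum (by omega) (hc x) (hc0 x), hc1]
      · simp [hc', hx, hd x hx]
    rw [key]
    apply ih (by omega)
    · intro y hy
      apply Finset.sum_eq_zero
      intro x _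
      by_cases hx : rk x = r + 1
      · simp [hc', hx, hcr x y hy (by omega) hx]
      · simp [hc', hx]
    · rw [Finset.sum_comm]
      apply Finset.sum_eq_zero
      intro x _
      by_cases hx : rk x = r + 1
      · simp [hc', hx, hc0 x]
      · simp [hc', hx]
    -- Index `0` of the rewritten identity turns the vanishing of `∑ x, d x` into the
    -- first-coefficient hypothesis in rank `r`.
    · have := key 0
      simp only [R.g_zero, Module.End.one_apply, h0] at this
      exact this.symm

end PathRep

/-- The representation of rank zero. -/
def PathRep.base (F : Type u) [Field F] {P : Type v} [PartialOrder P] [Fintype P] {rk : P → ℕ}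
    (hrk : IsUniformRank rk) : PathRep F rk 0 F where
  g _ k := if k = 0 then 1 else 0
  one := 1
  lam := LinearMap.id
  g_zero _ := by simp
  g_bot _ _ k := by simp
  g_covBy x y h h' := by
    have := hrk.covBy h
    omega
  lam_one := rfl
  lam_g_one x _ a := by simp
  leading r h h' := by omega

end SplittingAlg

/-! ### Adding one rank to a representation -/

namespace SplittingAlg

universe u w

namespace PathRep

variable {F : Type u} [Field F] {P : Type} {rk : P → ℕ} {m : ℕ} {V : Type w}
  [AddCommGroup V] [Module F V]

/-- The action of an operator on finitely supported families of vectors. -/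
noncomputable def mapOp (ι : Type*) (T : Module.End F V) : Module.End F (ι →₀ V) :=
  Finsupp.mapRange.linearMap T

theorem mapOp_apply (ι : Type*) (T : Module.End F V) (f : ι →₀ V) (i : ι) :
    mapOp ι T f i = T (f i) := rfl

/-- The operator that prepends a new letter with coefficients given by `ν`. -/
noncomputable def extOp {B : Type*} (one : V) (v : P) (ν : V →ₗ[F] (B →₀ F)) :
    Module.End F (List (P × B) →₀ V) :=
  Finsupp.lsum F fun L =>
    (Finsupp.linearCombination F fun b => Finsupp.single ((v, b) :: L) one) ∘ₗ ν

theorem extOp_eq_zero {B : Type*} {one : V} {v : P} {ν : V →ₗ[F] (B →₀ F)}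
    {f : List (P × B) →₀ V} (h : ∀ L, ν (f L) = 0) : extOp one v ν f = 0 := by
  simp [extOp, Finsupp.lsum_apply, Finsupp.sum, h]

theorem extOp_apply_nil {B : Type*} (one : V) (v : P) (ν : V →ₗ[F] (B →₀ F))
    (f : List (P × B) →₀ V) : extOp one v ν f [] = 0 := by
  induction f using Finsupp.induction_linear with
  | zero => simp
  | add f g hf hg => simp [hf, hg]
  | single L c =>
    simp only [extOp, Finsupp.lsum_apply]
    rw [Finsupp.sum_single_index (by simp), LinearMap.comp_apply]
    generalize ν c = a
    induction a using Finsupp.induction_linear with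
    | zero => simp
    | add f g hf hg => simp [hf, hg]
    | single b r => simp

theorem extOp_apply_cons [DecidableEq P] {B : Type*} (one : V) (v : P) (ν : V →ₗ[F] (B →₀ F))
    (f : List (P × B) →₀ V) (x : P) (b : B) (L : List (P × B)) :
    extOp one v ν f ((x, b) :: L) = if x = v then (ν (f L) b) • one else 0 := by
  classical
  induction f using Finsupp.induction_linear with
  | zero => simp
  | add f g hf hg =>
    rw [map_add, Finsupp.add_apply, hf, hg]
    split_ifs <;> simp [add_smul]
  | single L' c =>
    simp only [extOp, Finsupp.lsum_apply]
    rw [Finsupp.sum_single_index (by simp), LinearMap.comp_apply]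
    by_cases hL : L' = L
    · subst hL
      rw [Finsupp.single_eq_same]
      generalize ν c = a
      induction a using Finsupp.induction_linear with
      | zero => simp
      | add f g hf hg =>
        rw [map_add, Finsupp.add_apply, hf, hg]
        split_ifs <;> simp [add_smul]
      | single b' r =>
        simp only [Finsupp.linearCombination_single, Finsupp.smul_apply, Finsupp.single_apply,
          List.cons.injEq, Prod.mk.injEq, and_true]
        by_cases h1 : x = v
        · by_cases h2 : b' = b <;> simp [h1, h2]
        · simp [h1, Ne.symm h1]
    · rw [Finsupp.single_eq_of_ne (Ne.symm hL)]
      generalize ν c = a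
      simp only [map_zero, Finsupp.zero_apply, zero_smul, ite_self]
      induction a using Finsupp.induction_linear with
      | zero => simp
      | add f g hf hg => simp [hf, hg]
      | single b' r => simp [hL]

/-- The value of a new operator on the differences below `v` is prescribed. The prescription is
consistent by `sum_g_eq_zero`: if the first coefficients of a zero-sum family cancel, so do the
second ones. The extension to `V` keeps its values in sums of images of the `g y 2`, so `lam` still
kills them. -/
theorem exists_delta [PartialOrder P] [Fintype P] (hrk : IsUniformRank rk) (R : PathRep F rk m V) (v : P) (hv : rk v = m + 1) :
    ∃ δ : Module.End F V, (∀ c : P → V, (∀ y, y ∉ {y | y ⋖ v} → c y = 0) → ∑ y, c y = 0 →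
      δ (∑ y, R.g y 1 (c y)) = ∑ y, R.g y 2 (c y)) ∧ ∀ a, R.lam (δ a) = 0 := by
  obtain ⟨s, hs⟩ := exists_factor
    ((sumMap fun y => R.g y 1) ∘ₗ (zeroSum F V {y | y ⋖ v}).subtype)
    ((sumMap fun y => R.g y 2) ∘ₗ (zeroSum F V {y | y ⋖ v}).subtype) (by
      rintro ⟨c, hc, hc0⟩ h
      simp only [LinearMap.comp_apply, Submodule.subtype_apply, sumMap_apply] at h ⊢
      refine R.sum_g_eq_zero hrk m le_rfl c (fun x hx => hc x fun h' => hx ?_) hc0 h 2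
      have := hrk.covBy h'
      omega)
  refine ⟨(sumMap fun y => R.g y 2) ∘ₗ (zeroSum F V {y | y ⋖ v}).subtype ∘ₗ s, ?_, ?_⟩
  · intro c hc hc0
    have := hs ⟨c, hc, hc0⟩
    simpa only [LinearMap.comp_apply, Submodule.subtype_apply, sumMap_apply] using this
  · intro a
    simp only [LinearMap.comp_apply, Submodule.subtype_apply, sumMap_apply, map_sum]
    apply Finset.sum_eq_zero
    intro x _
    by_cases hx : x ⋖ v
    · have := hrk.covBy hx
      exact R.lam_g hrk x (by omega) 1 _
    · rw [(s a).2.1 x hx]; simp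

theorem mem_diffSpan_of_apply [Fintype P] {ι : Type*} {X : P → Module.End F V}
    {X' : P → Module.End F (ι →₀ V)} {S : Set P} (hX : ∀ y ∈ S, X' y = mapOp ι (X y)) {d : ι →₀ V}
    (h : ∀ i, d i ∈ diffSpan X S) : d ∈ diffSpan X' S := by
  classical
  rw [← Finsupp.sum_single d]
  refine Submodule.sum_mem _ fun i _ => ?_
  obtain ⟨c, h1, h2, h3⟩ := mem_diffSpan.1 (h i)
  refine mem_diffSpan.2 ⟨fun y => Finsupp.single i (c y), fun y hy => by simp [h1 y hy], ?_, ?_⟩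
  · ext j
    by_cases hj : i = j
    · subst hj; simp [Finsupp.finsetSum_apply, h2]
    · simp [Finsupp.finsetSum_apply, hj]
  · have h4 : ∀ y, X' y (Finsupp.single i (c y)) = Finsupp.single i (X y (c y)) := by
      intro y
      by_cases hy : y ∈ S
      · rw [hX y hy]; simp [mapOp]
      · simp [h1 y hy]
    simp_rw [h4, ← h3]
    ext j
    by_cases hj : i = j
    · subst hj; simp [Finsupp.finsetSum_apply]
    · simp [Finsupp.finsetSum_apply, hj]

/-- The operators for the elements of rank `m + 1`. -/
noncomputable def recOp {W : Type*} [AddCommGroup W] [Module F W] (g : ℕ → Module.End F W)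
    (X : Module.End F W) : ℕ → Module.End F W
  | 0 => 1
  | k + 1 => g (k + 1) + recOp g X k * (X - g 1)

theorem recOp_one {W : Type*} [AddCommGroup W] [Module F W] (g : ℕ → Module.End F W)
    (X : Module.End F W) : recOp g X 1 = X := by
  simp [recOp]

/-- One degree of the proof that `recOp` does not depend on the chosen lower cover: `x` is the new
operator, `a`, `b`, `l` are first coefficients of three elements below it, and `z` belongs to a
common lower cover of the elements of `a` and `b`. -/
theorem recOp_step {A : Type*} [Ring A] {x l a b z g Z L a1 b1 a2 b2 : A}
    (hx : x * (a - b) = a * (a - z) - b * (b - z)) (ha : g * (a - l) = a1 - L)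
    (hb : g * (b - l) = b1 - L) (ha2 : a2 = Z + a1 * (a - z)) (hb2 : b2 = Z + b1 * (b - z)) :
    (L + g * (x - l)) * (a - b) = a2 - b2 := by
  have h : (x - l) * (a - b) = (a - l) * (a - z) - (b - l) * (b - z) := by
    rw [sub_mul, hx]
    noncomm_ring
  rw [add_mul, mul_assoc, h, mul_sub g, ← mul_assoc, ← mul_assoc, ha, hb, ha2, hb2]
  noncomm_ring

theorem recOp_indep {A : Type*} [Ring A] {x a l g a1 L : A} (h : g * (a - l) = a1 - L) :
    L + g * (x - l) = a1 + g * (x - a) := by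
  rw [← sub_eq_zero, ← sub_eq_zero.2 h]
  noncomm_ring

/-- The new space consists of words with coefficients in `V`. Old operators act on the coefficients.
A new operator `X v` is the sum of the prescribed part `δ v` and a free part, which records a vector
modulo the differences below `v` as a new first letter with coefficient `one`. The prescribed part
secures the relations, the free part the independence in rank `m + 1`. -/
theorem exists_step [PartialOrder P] [Fintype P] (hrk : IsUniformRank rk) (R : PathRep F rk m V) :
    Nonempty (PathRep F rk (m + 1) (List (P × Module.Free.ChooseBasisIndex F V) →₀ V)) := by
  classical
  set B := Module.Free.ChooseBasisIndex F V
  have hδ : ∀ v, ∃ δ : Module.End F V, rk v = m + 1 →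
      ((∀ c : P → V, (∀ y, y ∉ {y | y ⋖ v} → c y = 0) → ∑ y, c y = 0 →
      δ (∑ y, R.g y 1 (c y)) = ∑ y, R.g y 2 (c y)) ∧ ∀ a, R.lam (δ a) = 0) := by
    intro v
    by_cases hv : rk v = m + 1
    · obtain ⟨δ, h⟩ := R.exists_delta hrk v hv
      exact ⟨δ, fun _ => h⟩
    · exact ⟨0, fun h => absurd h hv⟩
  choose δ hδ using hδ
  -- The kernel of `p v` is exactly the subspace on which `X v` is prescribed, so the free part
  -- vanishes there and is injective modulo it.
  have hp : ∀ v, ∃ p : Module.End F V, ∀ x, p x = 0 ↔ x ∈ diffSpan (fun y => R.g y 1) {y | y ⋖ v} :=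
    fun v => exists_end_ker _
  choose p hp using hp
  have hy : ∀ v, ∃ y, rk v ≠ 0 → y ⋖ v := by
    intro v
    by_cases hv : rk v = 0
    · exact ⟨v, fun h => absurd hv h⟩
    · obtain ⟨y, hy⟩ := hrk.exists_covBy hv
      exact ⟨y, fun _ => hy⟩
  choose low hlow using hy
  let b := Module.Free.chooseBasis F V
  let ν : P → V →ₗ[F] (B →₀ F) := fun v => b.repr.toLinearMap ∘ₗ p v
  have hν : ∀ v x, ν v x = 0 ↔ x ∈ diffSpan (fun y => R.g y 1) {y | y ⋖ v} := by
    intro v x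
    simp [ν, hp]
  let M := mapOp (F := F) (V := V) (List (P × B))
  have hMmul : ∀ S T, M (S * T) = M S * M T := fun S T => by ext; rfl
  have hMadd : ∀ S T, M (S + T) = M S + M T := fun S T => by ext; simp [M, mapOp_apply]
  have hMsub : ∀ S T, M (S - T) = M S - M T := fun S T => by ext; simp [M, mapOp_apply]
  have hMone : M 1 = 1 := by ext; simp [M, mapOp_apply]
  have hMzero : M 0 = 0 := by ext; simp [M, mapOp_apply]
  let X : P → Module.End F (List (P × B) →₀ V) := fun v => M (δ v) + extOp R.one v (ν v)
  let g : P → ℕ → Module.End F (List (P × B) →₀ V) := fun v k =>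
    if rk v ≤ m then M (R.g v k) else recOp (fun k => M (R.g (low v) k)) (X v) k
  have hg_old : ∀ v, rk v ≤ m → ∀ k, g v k = M (R.g v k) := fun v hv k => by simp [g, hv]
  have hg_new : ∀ v, rk v = m + 1 → g v 1 = X v := fun v hv => by
    simp [g, hv, recOp_one]
  -- the defining relation of the new operators
  have hX : ∀ v, rk v = m + 1 → ∀ c : P → (List (P × B) →₀ V),
      (∀ y, y ∉ {y | y ⋖ v} → c y = 0) → ∑ y, c y = 0 →
      X v (∑ y, M (R.g y 1) (c y)) = ∑ y, M (R.g y 2) (c y) := by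
    intro v hv c hc hc0
    have hL : ∀ L, (∀ y, y ∉ {y | y ⋖ v} → c y L = 0) ∧ ∑ y, c y L = 0 := by
      intro L
      refine ⟨fun y hy => by rw [hc y hy]; rfl, ?_⟩
      rw [← Finsupp.finsetSum_apply, hc0]; rfl
    have h1 : extOp R.one v (ν v) (∑ y, M (R.g y 1) (c y)) = 0 := by
      apply extOp_eq_zero
      intro L
      rw [hν, Finsupp.finsetSum_apply]
      exact mem_diffSpan.2 ⟨fun y => c y L, (hL L).1, (hL L).2, rfl⟩
    simp only [X, LinearMap.add_apply, h1, add_zero]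
    ext L
    simp only [M, mapOp_apply, Finsupp.finsetSum_apply]
    exact (hδ v hv).1 (fun y => c y L) (hL L).1 (hL L).2
  have hXd : ∀ v, rk v = m + 1 → ∀ y y', y ⋖ v → y' ⋖ v →
      X v * (M (R.g y 1) - M (R.g y' 1)) = M (R.g y 2) - M (R.g y' 2) := by
    intro v hv y y' hy hy'
    apply LinearMap.ext
    intro a
    have h := hX v hv (Pi.single y a - Pi.single y' a) ?_ (by simp [Finset.sum_sub_distrib])
    · simp only [Pi.sub_apply, map_sub, Finset.sum_sub_distrib] at h
      have h1 : ∀ (z : P) (k : ℕ), ∑ x, M (R.g x k) ((Pi.single z a : P → _) x) =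
          M (R.g z k) a := by
        intro z k
        rw [Finset.sum_eq_single z] <;> simp +contextual
      simp only [h1] at h
      simp only [Module.End.mul_apply, LinearMap.sub_apply, map_sub]
      exact h
    · intro z hz
      have h1 : z ≠ y := by rintro rfl; exact hz hy
      have h2 : z ≠ y' := by rintro rfl; exact hz hy'
      simp [h1, h2]
  have hold : ∀ x y, x ⋖ y → rk y ≤ m → ∀ k, M (R.g y (k + 1)) =
      M (R.g x (k + 1)) + M (R.g y k) * (M (R.g y 1) - M (R.g x 1)) := by
    intro x y hxy hy k
    rw [R.g_covBy x y hxy hy, hMadd, hMmul, hMsub]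
  have hdiff : ∀ v, rk v = m + 1 → ∀ k y y', y ⋖ v → y' ⋖ v →
      g v k * (M (R.g y 1) - M (R.g y' 1)) = M (R.g y (k + 1)) - M (R.g y' (k + 1)) := by
    intro v hv k
    have hlv := hlow v (by omega)
    have hgr : ∀ k, g v (k + 1) =
        M (R.g (low v) (k + 1)) + g v k * (X v - M (R.g (low v) 1)) := by
      intro k
      simp [g, hv, recOp]
    induction k with
    | zero => intro y y' _ _; simp [g, hv, recOp]
    | succ k ih =>
      intro y y' hy hy'
      by_cases hne : y = y'
      · subst hne; simp
      obtain ⟨z, hz, hz'⟩ := hrk.diamond hy hy' hne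
      have e1 := hrk.covBy hy
      have e2 := hrk.covBy hy'
      have e3 : X v * (M (R.g y 1) - M (R.g y' 1)) =
          M (R.g y 1) * (M (R.g y 1) - M (R.g z 1)) -
          M (R.g y' 1) * (M (R.g y' 1) - M (R.g z 1)) := by
        rw [hXd v hv y y' hy hy', hold z y hz (by omega), hold z y' hz' (by omega)]
        exact add_sub_add_left_eq_sub _ _ _
      rw [hgr]
      exact recOp_step e3 (ih y _ hy hlv) (ih y' _ hy' hlv) (hold z y hz (by omega) (k + 1))
        (hold z y' hz' (by omega) (k + 1))
  have hcov_new : ∀ x v, x ⋖ v → rk v = m + 1 → ∀ k,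
      g v (k + 1) = g x (k + 1) + g v k * (g v 1 - g x 1) := by
    intro x v hxv hv k
    have e1 := hrk.covBy hxv
    have hlv := hlow v (by omega)
    rw [hg_new v hv, hg_old x (by omega), hg_old x (by omega)]
    have h1 := hdiff v hv k x (low v) hxv hlv
    have h2 : g v (k + 1) = M (R.g (low v) (k + 1)) + g v k * (X v - M (R.g (low v) 1)) := by
      simp [g, hv, recOp]
    rw [h2]
    exact recOp_indep h1
  refine ⟨{ g := g
            one := Finsupp.single [] R.one
            lam := R.lam ∘ₗ Finsupp.lapply []
            g_zero := ?_, g_bot := ?_, g_covBy := ?_, lam_one := ?_, lam_g_one := ?_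
            leading := ?_ }⟩
  · intro x
    by_cases hx : rk x ≤ m
    · rw [hg_old x hx, R.g_zero, hMone]
    · simp [g, hx, recOp]
  · intro x hx k
    rw [hg_old x (by omega), R.g_bot x hx, hMzero]
  · intro x y hxy hy k
    have := hrk.covBy hxy
    by_cases h : rk y ≤ m
    · rw [hg_old y h, hg_old y h, hg_old y h, hg_old x (by omega), hg_old x (by omega)]
      exact hold x y hxy h k
    · exact hcov_new x y hxy (by omega) k
  · simp [R.lam_one]
  · intro x hx a
    by_cases h : rk x ≤ m
    · rw [hg_old x h]
      exact R.lam_g_one x h _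
    · rw [hg_new x (by omega)]
      simp only [X, LinearMap.add_apply, LinearMap.comp_apply, Finsupp.lapply_apply,
        Finsupp.add_apply, extOp_apply_nil, add_zero]
      exact (hδ x (by omega)).2 _
  · intro r hr1 hr d hd hsum x hx
    have hS : ∀ y ∈ {y | y ⋖ x}, g y 1 = M (R.g y 1) := by
      intro y hy
      have := hrk.covBy hy
      exact hg_old y (by omega) 1
    apply mem_diffSpan_of_apply hS
    intro L
    by_cases hrm : r ≤ m
    · refine R.leading r hr1 hrm (fun x => d x L) (fun x hx => by simp [hd x hx]) ?_ x hx
      have h1 := DFunLike.congr_fun hsum L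
      rw [Finsupp.finsetSum_apply] at h1
      rw [Finsupp.zero_apply] at h1
      rw [← h1]
      refine Finset.sum_congr rfl fun y _ => ?_
      by_cases hy : rk y ≤ m
      · rw [hg_old y hy]; rfl
      · rw [hd y (by omega)]; simp
    -- Here `r = m + 1`. Under `lam`, the component at `(x, i) :: L` only sees the letter prepended
    -- by `X x`: old operators and all `δ y` are killed, and the other new operators prepend other
    -- letters. What remains is the coordinate `i` of `ν x (d x L)`.
    · rw [← hν]
      ext i
      have h1 := congrArg R.lam (DFunLike.congr_fun hsum ((x, i) :: L))
      rw [Finsupp.finsetSum_apply, map_sum, Finset.sum_eq_single x] at h1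
      · rw [hg_new x (by omega)] at h1
        simp only [X, LinearMap.add_apply, Finsupp.add_apply, map_add, extOp_apply_cons, if_true,
          map_smul, R.lam_one, Finsupp.zero_apply, map_zero] at h1
        have h2 : R.lam (M (δ x) (d x) ((x, i) :: L)) = 0 := (hδ x (by omega)).2 _
        rw [h2] at h1
        simpa using h1
      · intro y _ hyx
        by_cases hy : rk y ≤ m
        · rw [hg_old y hy]
          exact R.lam_g_one y hy _
        · by_cases hy' : rk y = m + 1
          · rw [hg_new y hy']
            simp only [X, LinearMap.add_apply, Finsupp.add_apply, extOp_apply_cons,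
              if_neg (Ne.symm hyx), add_zero]
            exact (hδ y hy').2 _
          · rw [hd y (by omega)]; simp
      · simp

end PathRep

theorem exists_pathRep (F : Type u) [Field F] {P : Type} [PartialOrder P] [Fintype P] {rk : P → ℕ}
    (hrk : IsUniformRank rk) (m : ℕ) : ∃ (V : Type u) (_ : AddCommGroup V) (_ : Module F V),
      Nonempty (PathRep F rk m V) := by
  induction m with
  | zero => exact ⟨F, _, _, ⟨PathRep.base F hrk⟩⟩
  | succ m ih =>
    obtain ⟨V, _, _, ⟨R⟩⟩ := ih
    exact ⟨_, _, _, R.exists_step hrk⟩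

end SplittingAlg

/-! ### Normal words span -/

namespace SplittingAlg

universe u v w

section Words

variable {P : Type v} [PartialOrder P]

/-- The first letter of the word `W` belongs to an element of rank `r` below `v`. -/
def HeadBelow (rk : P → ℕ) (v : P) (r : ℕ) : List (P × ℕ) → Prop
  | [] => False
  | (u, _) :: _ => u < v ∧ rk u = r

/-- Normal words in the letters `(v, k)`, `1 ≤ k ≤ rk v`: the letter `(v, k)` is not followed by a
letter of an element of rank `rk v - k` below `v`. -/
def IsNormal (rk : P → ℕ) : List (P × ℕ) → Prop
  | [] => True
  | (v, k) :: W => (1 ≤ k ∧ k ≤ rk v) ∧ ¬ HeadBelow rk v (rk v - k) W ∧ IsNormal rk W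

omit [PartialOrder P] in
/-- The rank of the element of the first letter. -/
def headRank (rk : P → ℕ) : List (P × ℕ) → ℕ
  | [] => 0
  | (v, _) :: _ => rk v

omit [PartialOrder P] in
/-- The degree of a word. -/
def wdeg (W : List (P × ℕ)) : ℕ := (W.map Prod.snd).sum

omit [PartialOrder P] in
/-- The value of a word. -/
def wval {A : Type*} [Monoid A] (a : P → ℕ → A) (W : List (P × ℕ)) : A :=
  (W.map fun l => a l.1 l.2).prod

omit [PartialOrder P] in
@[simp] theorem wdeg_nil : wdeg ([] : List (P × ℕ)) = 0 := rfl

omit [PartialOrder P] in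
@[simp] theorem wdeg_cons (v : P) (k : ℕ) (W : List (P × ℕ)) :
    wdeg ((v, k) :: W) = k + wdeg W := by simp [wdeg]

omit [PartialOrder P] in
@[simp] theorem wval_nil {A : Type*} [Monoid A] (a : P → ℕ → A) : wval a [] = 1 := rfl

omit [PartialOrder P] in
@[simp] theorem wval_cons {A : Type*} [Monoid A] (a : P → ℕ → A) (v : P) (k : ℕ)
    (W : List (P × ℕ)) : wval a ((v, k) :: W) = a v k * wval a W := by simp [wval]

theorem isNormal_cons {rk : P → ℕ} {v : P} {k : ℕ} {W : List (P × ℕ)} :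
    IsNormal rk ((v, k) :: W) ↔
      (1 ≤ k ∧ k ≤ rk v) ∧ ¬ HeadBelow rk v (rk v - k) W ∧ IsNormal rk W := Iff.rfl

theorem HeadBelow.headRank_eq {rk : P → ℕ} {v : P} {r : ℕ} {W : List (P × ℕ)}
    (h : HeadBelow rk v r W) : headRank rk W = r := by
  match W, h with
  | (_, _) :: _, h => exact h.2

theorem HeadBelow.headRank_pos {rk : P → ℕ} {v : P} {r : ℕ} {W : List (P × ℕ)}
    (h : HeadBelow rk v r W) (hW : IsNormal rk W) : 0 < r := by
  match W, h with
  | (_, _) :: _, h =>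
    have h1 := hW.1
    have h2 := h.2
    omega

end Words

/-- The relations between the coefficients `a v k` of the polynomials attached to the elements
of a ranked poset. -/
structure IsPathFamily {P : Type v} [PartialOrder P] (rk : P → ℕ) {A : Type w} [Ring A]
    (a : P → ℕ → A) : Prop where
  zero : ∀ v, a v 0 = 1
  eq_zero : ∀ v k, rk v < k → a v k = 0
  covBy : ∀ y v, y ⋖ v → ∀ k, a v (k + 1) = a y (k + 1) + (a v 1 - a y 1) * a y k

section Spanning

variable {F : Type u} [Field F] {P : Type v} [PartialOrder P] {rk : P → ℕ} {A : Type w} [Ring A]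
  [Algebra F A] {a : P → ℕ → A}

omit [PartialOrder P] in
theorem mul_mem_of_span {S : Set A} {T : Submodule F A} {b : A} (h : ∀ x ∈ S, b * x ∈ T) :
    ∀ x ∈ Submodule.span F S, b * x ∈ T := by
  have h1 : Submodule.span F S ≤ T.comap (LinearMap.mulLeft F b) :=
    Submodule.span_le.2 fun x hx => h x hx
  exact fun x hx => h1 hx

variable (F rk a) in
/-- The span of the values of the normal words of degree `i`. -/
def normalSpan (i : ℕ) : Submodule F A :=
  Submodule.span F {x | ∃ W, IsNormal rk W ∧ wdeg W = i ∧ wval a W = x}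

variable (F rk a) in
/-- The span of the values of the normal words of degree `i` that begin in rank at most `r`. -/
def normalSpanLE (i r : ℕ) : Submodule F A :=
  Submodule.span F {x | ∃ W, IsNormal rk W ∧ wdeg W = i ∧ headRank rk W ≤ r ∧ wval a W = x}

theorem normalSpanLE_le (i r : ℕ) : normalSpanLE F rk a i r ≤ normalSpan F rk a i :=
  Submodule.span_mono fun _ ⟨W, h1, h2, _, h3⟩ => ⟨W, h1, h2, h3⟩

theorem normalSpanLE_mono (i : ℕ) {r r' : ℕ} (h : r ≤ r') :
    normalSpanLE F rk a i r ≤ normalSpanLE F rk a i r' :=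
  Submodule.span_mono fun _ ⟨W, h1, h2, h4, h3⟩ => ⟨W, h1, h2, h4.trans h, h3⟩

theorem wval_mem_normalSpan {W : List (P × ℕ)} (hW : IsNormal rk W) {i : ℕ} (hi : wdeg W = i) :
    wval a W ∈ normalSpan F rk a i :=
  Submodule.subset_span ⟨W, hW, hi, rfl⟩

variable (F rk a) in
/-- Multiplication by `a v 1` is well behaved in degrees below `n` and for ranks at most `r`. -/
def Controlled (n r : ℕ) : Prop :=
  ∀ j < n, ∀ v, rk v ≤ r → ∀ x ∈ normalSpan F rk a j, a v 1 * x ∈ normalSpanLE F rk a (j + 1) (rk v)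

theorem Controlled.mul_mem {n r : ℕ} (hn : Controlled F rk a n r) (hrk : IsUniformRank rk)
    (ha : IsPathFamily rk a) {v : P} (hv : rk v ≤ r) {i k : ℕ} (hik : i + (k + 1) ≤ n) {x : A}
    (hx : x ∈ normalSpan F rk a i) :
    a v (k + 1) * x ∈ normalSpanLE F rk a (i + (k + 1)) (rk v) := by
  induction hr : rk v using Nat.strong_induction_on generalizing v k with
  | _ s ih =>
    subst hr
    cases k with
    | zero => exact hn i (by omega) v hv x hx
    | succ k =>
      by_cases h0 : rk v = 0
      · rw [ha.eq_zero v _ (by omega), zero_mul]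
        exact zero_mem _
      · obtain ⟨y, hy⟩ := hrk.exists_covBy h0
        have h1 := hrk.covBy hy
        rw [ha.covBy y v hy, add_mul, mul_assoc, sub_mul]
        have h2 := normalSpanLE_le _ _ (ih (rk y) (by omega) (v := y) (k := k) (by omega)
          (by omega) rfl)
        refine add_mem ?_ (sub_mem ?_ ?_)
        · exact normalSpanLE_mono _ (by omega) (ih (rk y) (by omega) (v := y) (k := k + 1)
            (by omega) hik rfl)
        · exact hn (i + (k + 1)) (by omega) v hv _ h2
        · exact normalSpanLE_mono _ (by omega) (hn (i + (k + 1)) (by omega) y (by omega) _ h2)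

theorem Controlled.mul_mem' {n r : ℕ} (hn : Controlled F rk a n r) (hrk : IsUniformRank rk)
    (ha : IsPathFamily rk a) {v : P} (hv : rk v ≤ r) {i k : ℕ} (hik : i + k ≤ n) {x : A}
    (hx : x ∈ normalSpan F rk a i) :
    a v k * x ∈ normalSpan F rk a (i + k) := by
  cases k with
  | zero => rwa [ha.zero, one_mul]
  | succ k => exact normalSpanLE_le _ _ (hn.mul_mem hrk ha hv hik hx)

/-- Products of `a s 1` with differences of elements covered by `s` only involve lower ranks. -/
theorem Controlled.mul_sub_mem {n r : ℕ} (hn : Controlled F rk a n r) (hrk : IsUniformRank rk)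
    (ha : IsPathFamily rk a) {s t t' : P} (ht : t ⋖ s) (ht' : t' ⋖ s) (hr : rk t ≤ r) {i : ℕ}
    (hi : i + 2 ≤ n) {x : A} (hx : x ∈ normalSpan F rk a i) :
    a s 1 * (a t 1 * x - a t' 1 * x) ∈ normalSpanLE F rk a (i + 2) (rk t) := by
  have h1 := hrk.covBy ht
  have h2 := hrk.covBy ht'
  have h3 : ∀ t, t ⋖ s → a s 1 * (a t 1 * x) = a s 2 * x - (a t 2 * x - a t 1 * (a t 1 * x)) := by
    intro t ht
    rw [ha.covBy t s ht 1]
    noncomm_ring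
  have h4 : ∀ t, rk t ≤ r → a t 2 * x - a t 1 * (a t 1 * x) ∈ normalSpanLE F rk a (i + 2) (rk t) := by
    intro t ht
    refine sub_mem (hn.mul_mem hrk ha ht hi hx) (hn (i + 1) (by omega) t ht _ ?_)
    exact normalSpanLE_le _ _ (hn i (by omega) t ht x hx)
  rw [mul_sub, h3 t ht, h3 t' ht', sub_sub_sub_cancel_left]
  refine sub_mem ?_ (h4 t hr)
  have := h4 t' (by omega)
  rwa [show rk t' = rk t by omega] at this

variable (F rk a) in
/-- The span of a system of representatives modulo `diffSpanBelow`. -/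
def reprSpan (v u : P) (i : ℕ) : Submodule F A :=
  Submodule.span F {x | ∃ j W, j ≤ rk u ∧ j + wdeg W = i ∧ IsNormal rk W ∧
    ¬ HeadBelow rk v (rk u - j) W ∧ a u j * wval a W = x}

variable (F rk a) in
/-- The span of the elements `(a t 1 - a t' 1) * f` for `t`, `t'` of rank `ρ` below `v`. -/
def diffSpanBelow (v : P) (ρ i : ℕ) : Submodule F A :=
  Submodule.span F {x | ∃ t t' j f, t ≤ v ∧ t' ≤ v ∧ rk t = ρ ∧ rk t' = ρ ∧ j + 1 = i ∧
    f ∈ normalSpan F rk a j ∧ a t 1 * f - a t' 1 * f = x}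

theorem normalSpanLE_le_reprSpan (ha : IsPathFamily rk a) (v u : P) (i r : ℕ) (h : r < rk u) :
    normalSpanLE F rk a i r ≤ reprSpan F rk a v u i := by
  refine Submodule.span_le.2 ?_
  rintro _ ⟨W, h1, h2, h3, rfl⟩
  refine Submodule.subset_span ⟨0, W, by omega, by omega, h1, fun h' => ?_, by rw [ha.zero, one_mul]⟩
  have := h'.headRank_eq
  omega

/-- By the recursion along `y ⋖ u`, the products `a u 1 * a y j` and `a u (j + 1)` differ by terms
of rank at most `rk y`. Multiplication by `a u 1` thus raises the index of a representative by one,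
and only these leading terms have to be placed in `T`. -/
theorem mul_reprSpan_mem (hrk : IsUniformRank rk) (ha : IsPathFamily rk a) {v u y : P}
    (hy : y ⋖ u) {i : ℕ} (hn : Controlled F rk a (i + 1) (rk y)) {T : Submodule F A}
    (hT : normalSpanLE F rk a (i + 1) (rk y) ≤ T)
    (hlead : ∀ j W, j ≤ rk y → j + wdeg W = i → IsNormal rk W → ¬ HeadBelow rk v (rk y - j) W →
      a u (j + 1) * wval a W ∈ T) :
    ∀ x ∈ reprSpan F rk a v y i, a u 1 * x ∈ T := by
  apply mul_mem_of_span
  rintro _ ⟨j, W, h1, h2, h3, h4, rfl⟩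
  have h5 : a u 1 * (a y j * wval a W) = a u (j + 1) * wval a W -
      (a y (j + 1) * wval a W - a y 1 * (a y j * wval a W)) := by
    rw [ha.covBy y u hy j]
    noncomm_ring
  rw [h5]
  have h6 : wval a W ∈ normalSpan F rk a (wdeg W) := wval_mem_normalSpan h3 rfl
  refine sub_mem (hlead j W h1 h2 h3 h4) (hT (sub_mem ?_ ?_))
  · have := hn.mul_mem hrk ha le_rfl (by omega) h6 (k := j)
    rwa [show wdeg W + (j + 1) = i + 1 by omega] at this
  · refine hn i (by omega) y le_rfl _ ?_
    have := hn.mul_mem' hrk ha le_rfl (by omega) h6 (k := j)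
    rwa [show wdeg W + j = i by omega] at this

/-- A word fails to be a representative with `j = 0` only if it begins at some `s < v` of the rank
of `u`. Modulo lower rank and one difference its leading letter can be moved from `s` to `u`; the
remaining factor is then decomposed in one degree and one rank less. -/
theorem normalSpan_le_sup [Finite P] (hrk : IsUniformRank rk) (ha : IsPathFamily rk a) (v : P)
    (i : ℕ) (hn : ∀ r, Controlled F rk a i r) (u : P) (huv : u < v) :
    normalSpan F rk a i ≤ reprSpan F rk a v u i ⊔ diffSpanBelow F rk a v (rk u) i := by
  induction hr : rk u generalizing u i with
  | zero =>
    refine le_trans (Submodule.span_le.2 ?_) le_sup_left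
    rintro _ ⟨W, h1, h2, rfl⟩
    refine Submodule.subset_span ⟨0, W, by omega, by omega, h1, fun h' => ?_,
      by rw [ha.zero, one_mul]⟩
    have := h'.headRank_pos h1
    omega
  | succ ρ ih =>
    have hvr := hrk.strictMono huv
    refine Submodule.span_le.2 ?_
    rintro _ ⟨W, h1, h2, rfl⟩
    by_cases hW : HeadBelow rk v (rk u) W
    swap
    · exact Submodule.mem_sup_left (Submodule.subset_span ⟨0, W, by omega, by omega, h1, hW,
        by rw [ha.zero, one_mul]⟩)
    match W, hW with
    | (s, l) :: W, hW =>
    obtain ⟨hsv, hsu⟩ := hW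
    obtain ⟨⟨hl1, hl2⟩, -, hW⟩ := h1
    obtain ⟨l, rfl⟩ : ∃ l', l = l' + 1 := ⟨l - 1, by omega⟩
    obtain ⟨t, ht⟩ := hrk.exists_covBy (y := s) (by omega)
    have hts := hrk.covBy ht
    rw [wdeg_cons] at h2
    obtain ⟨i, rfl⟩ : ∃ i', i = i' + 1 := ⟨i - 1, by omega⟩
    set z := a t l * wval a W with hz
    have hWm : wval a W ∈ normalSpan F rk a (wdeg W) := wval_mem_normalSpan hW rfl
    have hzm : z ∈ normalSpan F rk a i := by
      have := (hn (rk t)).mul_mem' hrk ha le_rfl (by omega) hWm (k := l)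
      rwa [show wdeg W + l = i by omega] at this
    -- The first bracket has rank at most `rk t`, the second is a difference in the rank of `u`, and
    -- only `a u 1 * z` needs the induction hypothesis.
    have e1 : wval a ((s, l + 1) :: W) =
        (a t (l + 1) * wval a W - a t 1 * z) + (a s 1 * z - a u 1 * z) + a u 1 * z := by
      rw [wval_cons, ha.covBy t s ht l, hz]
      noncomm_ring
    rw [SetLike.mem_coe, e1]
    refine add_mem (add_mem (Submodule.mem_sup_left ?_) (Submodule.mem_sup_right ?_)) ?_
    · refine normalSpanLE_le_reprSpan ha v u (i + 1) (rk t) (by omega) (sub_mem ?_ ?_)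
      · have := (hn (rk t)).mul_mem hrk ha le_rfl (by omega) hWm (k := l)
        rwa [show wdeg W + (l + 1) = i + 1 by omega] at this
      · exact hn _ i (by omega) t le_rfl z hzm
    · exact Submodule.subset_span ⟨s, u, i, z, hsv.le, huv.le, by omega, by omega, rfl, hzm, rfl⟩
    obtain ⟨y, hy⟩ := hrk.exists_covBy (y := u) (by omega)
    have hyu := hrk.covBy hy
    obtain ⟨p, hp, q, hq, hpq⟩ := Submodule.mem_sup.1 (ih i
      (fun r j hj => hn r j (by omega)) y (hy.lt.trans huv) (by omega) hzm)
    rw [← hpq, mul_add]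
    refine add_mem (Submodule.mem_sup_left ?_) ?_
    · refine mul_reprSpan_mem hrk ha hy (hn _) (normalSpanLE_le_reprSpan ha v u _ _ (by omega)) ?_
        p hp
      intro j W h3 h4 h5 h6
      refine Submodule.subset_span ⟨j + 1, W, by omega, by omega, h5, ?_, rfl⟩
      rwa [show rk u - (j + 1) = rk y - j by omega]
    · clear hpq
      revert q
      apply mul_mem_of_span
      rintro _ ⟨t, t', j, f, htv, htv', htr, htr', hj, hf, rfl⟩
      -- By `connected` it suffices to treat `t`, `t'` covered by a common `s ≤ v`. There `a u 1` is
      -- exchanged for `a s 1` at the cost of an element of `diffSpanBelow`, and `a s 1` sends the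
      -- difference to lower rank.
      let E : P → P → Prop := fun t t' => rk t = ρ → rk t' = ρ ∧ a u 1 * (a t 1 * f - a t' 1 * f) ∈
          reprSpan F rk a v u (i + 1) ⊔ diffSpanBelow F rk a v (ρ + 1) (i + 1)
      refine (hrk.connected E ?_ v ?_ t t' htv htv' (by omega) (by omega) htr).2
      · intro x y z hxy hyz hx
        obtain ⟨h1, h2⟩ := hxy hx
        obtain ⟨h3, h4⟩ := hyz h1
        refine ⟨h3, ?_⟩
        have := add_mem h2 h4
        rwa [← mul_add, sub_add_sub_cancel] at this
      · intro s hs t t' ht ht' htr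
        have h1 := hrk.covBy ht
        have h2 := hrk.covBy ht'
        refine ⟨by omega, ?_⟩
        set g := a t 1 * f - a t' 1 * f with hg
        have hgm : g ∈ normalSpan F rk a i := by
          have : ∀ t, a t 1 * f ∈ normalSpan F rk a i := fun t => by
            have := normalSpanLE_le _ _ (hn (rk t) j (by omega) t le_rfl f hf)
            rwa [hj] at this
          exact sub_mem (this t) (this t')
        rw [← sub_add_cancel (a u 1 * g) (a s 1 * g)]
        refine add_mem (Submodule.mem_sup_right ?_) (Submodule.mem_sup_left ?_)
        · exact Submodule.subset_span ⟨u, s, i, g, huv.le, hs, by omega, by omega, rfl, hgm, rfl⟩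
        · have := (hn (rk t)).mul_sub_mem hrk ha ht ht' le_rfl (i := j) (by omega) hf
          rw [show j + 2 = i + 1 by omega] at this
          exact normalSpanLE_le_reprSpan ha v u _ _ (by omega) this

/-- Induction on degree, then on rank. In the decomposition of `normalSpan_le_sup` below `v`, taken
at a lower cover `y`, multiplication by `a v 1` turns representatives into normal words beginning at
`v` plus lower terms, and turns differences into lower terms. -/
theorem controlled [Finite P] (hrk : IsUniformRank rk) (ha : IsPathFamily rk a) (n r : ℕ) :
    Controlled F rk a n r := by
  induction n generalizing r with
  | zero => intro j hj; omega
  | succ i ih =>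
    induction r using Nat.strong_induction_on with
    | _ r ihr =>
      intro j hj v hv x hx
      rcases Nat.lt_succ_iff_lt_or_eq.1 hj with hj | rfl
      · exact ih r j hj v hv x hx
      by_cases h0 : rk v = 0
      · rw [ha.eq_zero v _ (by omega), zero_mul]
        exact zero_mem _
      obtain ⟨y, hy⟩ := hrk.exists_covBy h0
      have hyv := hrk.covBy hy
      have hc : Controlled F rk a (j + 1) (rk y) := ihr (rk y) (by omega)
      obtain ⟨p, hp, q, hq, rfl⟩ := Submodule.mem_sup.1
        (normalSpan_le_sup hrk ha v j ih y hy.lt hx)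
      rw [mul_add]
      refine add_mem ?_ ?_
      · refine mul_reprSpan_mem hrk ha hy hc (normalSpanLE_mono _ (by omega)) ?_ p hp
        intro k W h3 h4 h5 h6
        -- As `rk v - (k + 1) = rk y - k`, the condition on representatives is precisely the
        -- normality of `(v, k + 1) :: W`.
        refine Submodule.subset_span ⟨(v, k + 1) :: W, ⟨⟨by omega, by omega⟩, ?_, h5⟩, ?_, le_rfl, ?_⟩
        · rwa [show rk v - (k + 1) = rk y - k by omega]
        · rw [wdeg_cons]; omega
        · rw [wval_cons]
      · clear hx
        revert q
        apply mul_mem_of_span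
        rintro _ ⟨t, t', k, f, htv, htv', htr, htr', hk, hf, rfl⟩
        have := hc.mul_sub_mem hrk ha (hrk.covBy_of_le htv (by omega))
          (hrk.covBy_of_le htv' (by omega)) (by omega) (i := k) (by omega) hf
        rw [show k + 2 = j + 1 by omega] at this
        exact normalSpanLE_mono _ (by omega) this

/-- The span of the normal words is stable under left multiplication by `a v 1`. -/
theorem mul_normalSpan_mem [Finite P] (hrk : IsUniformRank rk) (ha : IsPathFamily rk a) (v : P)
    (i : ℕ) {x : A} (hx : x ∈ normalSpan F rk a i) : a v 1 * x ∈ normalSpan F rk a (i + 1) :=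
  normalSpanLE_le _ _ (controlled hrk ha (i + 1) (rk v) i (by omega) v le_rfl x hx)

end Spanning

end SplittingAlg

/-! ### Normal words are linearly independent -/

namespace SplittingAlg

universe u v w

section Independence

variable {F : Type u} [Field F] {P : Type v}

/-- The part of `φ` that is supported on the words with first letter `l`, without this letter. -/
noncomputable def tailPart (l : P × ℕ) (φ : List (P × ℕ) →₀ F) : List (P × ℕ) →₀ F :=
  φ.comapDomain (List.cons l) (List.cons_injective.injOn)

@[simp] theorem tailPart_apply (l : P × ℕ) (φ : List (P × ℕ) →₀ F) (W : List (P × ℕ)) :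
    tailPart l φ W = φ (l :: W) := rfl

variable [PartialOrder P] [Fintype P] {rk : P → ℕ} {m : ℕ}
  {V : Type w} [AddCommGroup V] [Module F V] {a : P → ℕ → Module.End F V}

variable (a) in
/-- The evaluation of a combination of words at a vector. -/
noncomputable def evalAt (o : V) : (List (P × ℕ) →₀ F) →ₗ[F] V :=
  Finsupp.linearCombination F fun W => wval a W o

omit [PartialOrder P] [Fintype P] in
theorem evalAt_mapDomain_cons (o : V) (v : P) (k : ℕ) (φ : List (P × ℕ) →₀ F) :
    evalAt a o (φ.mapDomain (List.cons (v, k))) = a v k (evalAt a o φ) := by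
  rw [evalAt, Finsupp.linearCombination_mapDomain, Finsupp.apply_linearCombination]
  congr 1

/-- Combinations of normal words of degree `i`. -/
def IsNormalComb (rk : P → ℕ) (i : ℕ) (φ : List (P × ℕ) →₀ F) : Prop :=
  ∀ W, φ W ≠ 0 → IsNormal rk W ∧ wdeg W = i

theorem IsNormalComb.eq_decomp {i : ℕ} {φ : List (P × ℕ) →₀ F} (h : IsNormalComb rk i φ) :
    φ = Finsupp.single [] (φ []) + ∑ v, ∑ j ∈ Finset.range (rk v),
      (tailPart (v, j + 1) φ).mapDomain (List.cons (v, j + 1)) := by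
  classical
  ext W
  match W with
  | [] =>
    simp only [Finsupp.add_apply, Finsupp.single_eq_same, Finsupp.finsetSum_apply]
    rw [Finset.sum_eq_zero, add_zero]
    intro v _
    refine Finset.sum_eq_zero fun j _ => Finsupp.mapDomain_of_notMem_range _ _ ?_
    rintro ⟨_, h⟩
    cases h
  | (u, l) :: W =>
    have h1 : ∀ v j, ((tailPart (v, j + 1) φ).mapDomain (List.cons (v, j + 1))) ((u, l) :: W) =
        if v = u ∧ j + 1 = l then φ ((u, l) :: W) else 0 := by
      intro v j
      split_ifs with h2
      · obtain ⟨rfl, rfl⟩ := h2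
        rw [Finsupp.mapDomain_apply List.cons_injective]
        rfl
      · refine Finsupp.mapDomain_of_notMem_range _ _ ?_
        rintro ⟨_, h⟩
        cases h
        exact h2 ⟨rfl, rfl⟩
    simp only [Finsupp.add_apply, Finsupp.finsetSum_apply, h1]
    rw [Finsupp.single_eq_of_ne (by simp), zero_add]
    by_cases h0 : φ ((u, l) :: W) = 0
    · simp [h0]
    · obtain ⟨⟨⟨hl, hl'⟩, -⟩, -⟩ := h _ h0
      rw [Finset.sum_eq_single u, Finset.sum_eq_single (l - 1)]
      · rw [if_pos ⟨rfl, by omega⟩]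
      · intro j _ hj
        rw [if_neg]; omega
      · intro hj
        rw [Finset.mem_range] at hj; omega
      · intro v _ hv
        simp [hv]
      · simp

theorem IsNormalComb.evalAt_eq {i : ℕ} {φ : List (P × ℕ) →₀ F} (h : IsNormalComb rk i φ) (o : V) :
    evalAt a o φ = φ [] • o + ∑ v, ∑ j ∈ Finset.range (rk v),
      a v (j + 1) (evalAt a o (tailPart (v, j + 1) φ)) := by
  conv_lhs => rw [h.eq_decomp]
  rw [map_add, map_sum]
  congr 1
  · simp [evalAt]
  · refine Finset.sum_congr rfl fun v _ => ?_
    rw [map_sum]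
    exact Finset.sum_congr rfl fun j _ => evalAt_mapDomain_cons _ _ _ _

omit [Fintype P] in
theorem IsNormalComb.apply_nil {i : ℕ} {φ : List (P × ℕ) →₀ F} (h : IsNormalComb rk (i + 1) φ) :
    φ [] = 0 := by
  by_contra h0
  have := (h _ h0).2
  simp at this

omit [Fintype P] in
theorem IsNormalComb.tailPart_eq_zero {i : ℕ} {φ : List (P × ℕ) →₀ F} (h : IsNormalComb rk i φ)
    {v : P} {k : ℕ} (hk : k = 0 ∨ rk v < k) : tailPart (v, k) φ = 0 := by
  ext W
  by_contra h0
  have := (h _ h0).1.1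
  omega

variable (rk) in
/-- The span of the images of the operators `X x` for `x` of rank at most `r`. -/
def lowSpan (X : P → Module.End F V) (r : ℕ) : Submodule F V :=
  ⨆ x : P, ⨆ _ : rk x ≤ r, LinearMap.range (X x)

omit [Fintype P] [PartialOrder P] in
theorem mem_lowSpan {X : P → Module.End F V} {r : ℕ} {x : P} (hx : rk x ≤ r) (y : V) :
    X x y ∈ lowSpan rk X r :=
  Submodule.mem_iSup_of_mem x (Submodule.mem_iSup_of_mem hx ⟨y, rfl⟩)

omit [Fintype P] [PartialOrder P] in
theorem lowSpan_mono (X : P → Module.End F V) {r r' : ℕ} (h : r ≤ r') :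
    lowSpan rk X r ≤ lowSpan rk X r' :=
  iSup_mono fun _ => iSup_le fun hx => le_iSup_of_le (hx.trans h) le_rfl

omit [PartialOrder P] in
theorem exists_of_mem_lowSpan {X : P → Module.End F V} {r : ℕ} {y : V} (hy : y ∈ lowSpan rk X r) :
    ∃ e : P → V, (∀ x, r < rk x → e x = 0) ∧ ∑ x, X x (e x) = y := by
  classical
  have h : lowSpan rk X r ≤ (Submodule.pi Set.univ
      (fun x => if rk x ≤ r then (⊤ : Submodule F V) else ⊥)).map (sumMap X) := by
    refine iSup_le fun x => iSup_le fun hx => ?_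
    rintro _ ⟨z, rfl⟩
    refine ⟨Pi.single x z, ?_, ?_⟩
    · intro x' _
      by_cases h : x' = x
      · subst h; simp [hx]
      · simp [h]
    · rw [sumMap_apply, Finset.sum_eq_single x] <;> simp +contextual
  obtain ⟨e, he, rfl⟩ := h hy
  refine ⟨e, fun x hx => ?_, (sumMap_apply X e).symm⟩
  have := he x (Set.mem_univ x)
  simpa [not_le.2 hx] using this

omit [Fintype P] in
theorem apply_mem_lowSpan (hrk : IsUniformRank rk) (ha : IsPathFamily rk a)
    {X : P → Module.End F V} (hX : ∀ v, a v 1 = -X v) (v : P) (k : ℕ) (x : V) :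
    a v (k + 1) x ∈ lowSpan rk X (rk v) := by
  induction hn : rk v using Nat.strong_induction_on generalizing v k with
  | _ n ih =>
    subst hn
    by_cases h0 : rk v = 0
    · cases k with
      | zero =>
        rw [hX, LinearMap.neg_apply]
        exact neg_mem (mem_lowSpan le_rfl _)
      | succ k =>
        rw [ha.eq_zero v _ (by omega)]
        exact zero_mem _
    · obtain ⟨y, hy⟩ := hrk.exists_covBy h0
      have h1 := hrk.covBy hy
      rw [ha.covBy y v hy, hX, hX, LinearMap.add_apply, Module.End.mul_apply, LinearMap.sub_apply,
        LinearMap.neg_apply, LinearMap.neg_apply]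
      refine add_mem (lowSpan_mono X (by omega) (ih (rk y) (by omega) y k rfl)) (sub_mem ?_ ?_)
      · exact neg_mem (mem_lowSpan le_rfl _)
      · exact neg_mem (mem_lowSpan (by omega) _)

omit [Fintype P] in
/-- The leading part of a combination of the operators `a v k`, `k ≥ 1`. -/
theorem sum_add_mem_lowSpan (hrk : IsUniformRank rk) (ha : IsPathFamily rk a)
    {X : P → Module.End F V} (hX : ∀ v, a v 1 = -X v) {y v : P} (hy : y ⋖ v) (ψ : ℕ → V) :
    ∑ j ∈ Finset.range (rk v), a v (j + 1) (ψ j) +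
      X v (∑ j ∈ Finset.range (rk v), a y j (ψ j)) ∈ lowSpan rk X (rk y) := by
  rw [map_sum, ← Finset.sum_add_distrib]
  refine Submodule.sum_mem _ fun j _ => ?_
  rw [ha.covBy y v hy, hX, hX, LinearMap.add_apply, Module.End.mul_apply, LinearMap.sub_apply,
    LinearMap.neg_apply, LinearMap.neg_apply]
  have : a y (j + 1) (ψ j) + (-X v (a y j (ψ j)) - -X y (a y j (ψ j))) + X v (a y j (ψ j)) =
      a y (j + 1) (ψ j) + X y (a y j (ψ j)) := by abel
  rw [this]
  exact add_mem (apply_mem_lowSpan hrk ha hX y j _) (mem_lowSpan le_rfl _)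

/-- Each `g x 1 (d x)` becomes a sum of second coefficients one rank lower. The combined family has
sum zero, and its first coefficients add up to `∑ x, d x = 0`, so `sum_g_eq_zero` applies. -/
theorem PathRep.sum_eq_zero_of_mem (hrk : IsUniformRank rk) (R : PathRep F rk m V) (s : ℕ)
    (hs : s ≤ m) (d : P → V) (hd : ∀ x, rk x ≠ s → d x = 0) (h0 : ∑ x, d x = 0)
    (hJ : ∀ x, rk x = s → d x ∈ diffSpan (fun y => R.g y 1) {y | y ⋖ x}) :
    ∑ x, R.g x 1 (d x) = 0 := by
  have h2 : ∀ x, ∃ c : P → V, (∀ y, y ∉ {y | y ⋖ x} → c y = 0) ∧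
      (rk x ≠ s → c = 0) ∧ ∑ y, c y = 0 ∧ ∑ y, R.g y 1 (c y) = d x := by
    intro x
    by_cases hx : rk x = s
    · obtain ⟨c, h1, h2, h3⟩ := mem_diffSpan.1 (hJ x hx)
      exact ⟨c, h1, fun h => absurd hx h, h2, h3⟩
    · exact ⟨0, by simp, by simp, by simp, by simp [hd x hx]⟩
  choose c hc hcs hc0 hc1 using h2
  have h3 : ∀ x, R.g x 1 (d x) = ∑ y, R.g y 2 (c x y) := by
    intro x
    by_cases hx : rk x = s
    · rw [← hc1, R.g_sum (by omega) (hc x) (hc0 x)]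
    · simp [hd x hx, hcs x hx]
  simp_rw [h3]
  rw [Finset.sum_comm]
  simp_rw [← map_sum]
  refine R.sum_g_eq_zero hrk (s - 1) (by omega) (fun y => ∑ x, c x y) ?_ ?_ ?_ 2
  · intro y hy
    refine Finset.sum_eq_zero fun x _ => ?_
    by_cases hx : rk x = s
    · refine hc x y fun h => hy ?_
      have := hrk.covBy h
      omega
    · simp [hcs x hx]
  · rw [Finset.sum_comm]
    exact Finset.sum_eq_zero fun x _ => hc0 x
  · simp_rw [map_sum]
    rw [Finset.sum_comm]
    simp_rw [hc1]
    exact h0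

section

variable (hrk : IsUniformRank rk) (ha : IsPathFamily rk a) (R : PathRep F rk m V)
  (hX : ∀ v, a v 1 = -R.g v 1) (hm : ∀ v, rk v ≤ m) (low : P → P) (hlow : ∀ v, rk v ≠ 0 → low v ⋖ v)

include hrk ha hX hm hlow

/-- The components of leading rank `s` in a combination of normal words. -/
theorem leading_mem {i s : ℕ} (hs : s ≠ 0) {φ : List (P × ℕ) →₀ F}
    (hφ : IsNormalComb rk (i + 1) φ) (hhead : ∀ x, s < rk x → ∀ k, tailPart (x, k) φ = 0)
    {d : P → V} (hd : ∀ x, rk x ≠ s → d x = 0)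
    (hmem : evalAt a R.one φ - ∑ x, R.g x 1 (d x) ∈ lowSpan rk (fun x => R.g x 1) (s - 1))
    {x : P} (hx : rk x = s) :
    ∑ j ∈ Finset.range (rk x), a (low x) j (evalAt a R.one (tailPart (x, j + 1) φ)) + d x ∈
      diffSpan (fun y => R.g y 1) {y | y ⋖ x} := by
  classical
  set L : P → V := fun x =>
    ∑ j ∈ Finset.range (rk x), a (low x) j (evalAt a R.one (tailPart (x, j + 1) φ)) with hL
  set d' : P → V := fun x => if rk x = s then L x + d x else 0 with hd'
  have h1 : ∑ x, R.g x 1 (d' x) ∈ lowSpan rk (fun x => R.g x 1) (s - 1) := by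
    have h2 : ∑ x, R.g x 1 (d' x) = ∑ x, (R.g x 1 (if rk x = s then L x else 0) +
        ∑ j ∈ Finset.range (rk x), a x (j + 1) (evalAt a R.one (tailPart (x, j + 1) φ))) -
        (evalAt a R.one φ - ∑ x, R.g x 1 (d x)) := by
      rw [hφ.evalAt_eq, hφ.apply_nil, zero_smul, zero_add, Finset.sum_add_distrib,
        add_sub_assoc, sub_sub_cancel, ← Finset.sum_add_distrib]
      refine Finset.sum_congr rfl fun x _ => ?_
      rw [← map_add]
      by_cases hx : rk x = s
      · simp [hd', hx]
      · simp [hd', hx, hd x hx]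
    rw [h2]
    refine sub_mem (Submodule.sum_mem _ fun x _ => ?_) hmem
    rcases lt_trichotomy (rk x) s with h | h | h
    · rw [if_neg h.ne, map_zero, zero_add]
      refine Submodule.sum_mem _ fun j _ => lowSpan_mono _ ?_ (apply_mem_lowSpan hrk ha hX x j _)
      omega
    · rw [if_pos h, add_comm]
      have h3 := hlow x (by omega)
      have h4 := hrk.covBy h3
      have := sum_add_mem_lowSpan hrk ha hX h3
        (fun j => evalAt a R.one (tailPart (x, j + 1) φ))
      rwa [show rk (low x) = s - 1 by omega] at this
    · rw [if_neg h.ne', map_zero, zero_add]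
      refine Submodule.sum_mem _ fun j _ => ?_
      rw [hhead x h, map_zero, map_zero]
      exact zero_mem _
  obtain ⟨e, he, he'⟩ := exists_of_mem_lowSpan h1
  have h2 := R.leading s (by omega) (hx ▸ hm x) (fun x => d' x - e x) (fun x hx => ?_) ?_ x hx
  · simp only [hd', if_pos hx, he x (by omega), sub_zero] at h2
    exact h2
  · simp [hd', hx.ne', he x (by omega)]
  · simp only [map_sub, Finset.sum_sub_distrib]
    rw [he', sub_self]

variable (rk a) in
omit hrk ha hX hm hlow in
/-- The representatives `a u j * W` are independent modulo the span of differences. -/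
def IndepMod (R : PathRep F rk m V) (i : ℕ) : Prop :=
  ∀ v u : P, u < v → ∀ φ : ℕ → (List (P × ℕ) →₀ F),
    (∀ j ≤ rk u, ∀ W, φ j W ≠ 0 → IsNormal rk W ∧ j + wdeg W = i ∧ ¬ HeadBelow rk v (rk u - j) W) →
    ∑ j ∈ Finset.range (rk u + 1), a u j (evalAt a R.one (φ j)) ∈
      diffSpan (fun y => R.g y 1) {t | t ≤ v ∧ rk t = rk u} →
    ∀ j ≤ rk u, φ j = 0

/-- In the highest rank that occurs, `leading_mem` puts the stripped words below `v` into the span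
of differences. Normality makes them representatives for `v` and `low v`, so `IndepMod` in degree
`i` kills them. -/
theorem tailPart_eq_zero_of_mem_lowSpan {i : ℕ} (hD : IndepMod rk a R i) {φ : List (P × ℕ) →₀ F}
    (hφ : IsNormalComb rk (i + 1) φ) (r : ℕ)
    (hmem : evalAt a R.one φ ∈ lowSpan rk (fun x => R.g x 1) r) :
    ∀ v, r < rk v → ∀ k, tailPart (v, k) φ = 0 := by
  -- Descending induction on the rank, which is bounded by `m`; for `n = 0` the statement is empty.
  suffices ∀ n v, r < rk v → m < rk v + n → ∀ k, tailPart (v, k) φ = 0 from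
    fun v hv => this (m + 1) v hv (by omega)
  intro n
  induction n with
  | zero =>
    intro v _ h
    have := hm v
    omega
  | succ n ih =>
    intro v hv hn k
    have h1 := leading_mem hrk ha R hX hm low hlow (s := rk v) (d := 0) (by omega) hφ
      (fun x hx k => ih x (by omega) (by omega) k) (by simp)
      (by simpa using lowSpan_mono _ (by omega) hmem) rfl
    rw [Pi.zero_apply, add_zero] at h1
    have h2 := hlow v (by omega)
    have h3 := hrk.covBy h2
    have h4 := hD v (low v) h2.lt (fun j => tailPart (v, j + 1) φ) ?_ ?_
    · by_cases hk : k = 0 ∨ rk v < k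
      · exact hφ.tailPart_eq_zero hk
      · have := h4 (k - 1) (by omega)
        rwa [show k - 1 + 1 = k by omega] at this
    · intro j hj W hW
      obtain ⟨⟨-, h5, h6⟩, h7⟩ := hφ _ hW
      rw [wdeg_cons] at h7
      refine ⟨h6, by omega, ?_⟩
      rwa [show rk (low v) - j = rk v - (j + 1) by omega]
    · rw [← h3]
      refine diffSpan_mono ?_ h1
      intro y hy
      have := hrk.covBy hy
      exact ⟨hy.le, by omega⟩

omit [Fintype P] hrk ha hX hm hlow in
theorem IsNormalComb.eq_single {φ : List (P × ℕ) →₀ F} (hφ : IsNormalComb rk 0 φ) :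
    φ = Finsupp.single [] (φ []) := by
  ext W
  match W with
  | [] => simp
  | (v, k) :: W =>
    rw [Finsupp.single_eq_of_ne (by simp)]
    by_contra h
    obtain ⟨⟨h1, -⟩, h2⟩ := hφ _ h
    rw [wdeg_cons] at h2
    omega

omit hrk ha hX hlow in
theorem lam_diffSpan {S : Set P} {x : V} (hx : x ∈ diffSpan (fun y => R.g y 1) S) :
    R.lam x = 0 := by
  obtain ⟨c, -, -, rfl⟩ := mem_diffSpan.1 hx
  rw [map_sum]
  exact Finset.sum_eq_zero fun y _ => R.lam_g_one y (hm y) _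

omit hrk ha hX hm hlow in
theorem eq_zero_of_lam {φ : List (P × ℕ) →₀ F} (hφ : IsNormalComb rk 0 φ)
    (h : R.lam (evalAt a R.one φ) = 0) : φ = 0 := by
  have h1 := hφ.eq_single
  rw [h1, evalAt, Finsupp.linearCombination_single, wval_nil, map_smul, Module.End.one_apply,
    R.lam_one, smul_eq_mul, mul_one] at h
  rw [h1, h, Finsupp.single_zero]

theorem eq_zero_of_evalAt_eq_zero {i : ℕ} (hD : IndepMod rk a R i) {φ : List (P × ℕ) →₀ F}
    (hφ : IsNormalComb rk (i + 1) φ) (h : evalAt a R.one φ = 0) : φ = 0 := by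
  have h1 := tailPart_eq_zero_of_mem_lowSpan hrk ha R hX hm low hlow hD hφ 0
    (by rw [h]; exact zero_mem _)
  ext W
  match W with
  | [] => exact hφ.apply_nil
  | (v, k) :: W =>
    by_contra h0
    by_cases hv : 0 < rk v
    · exact h0 (DFunLike.congr_fun (h1 v hv k) W)
    · have := (hφ _ h0).1.1
      omega

omit hrk hX hlow in
theorem indepMod_zero : IndepMod rk a R 0 := by
  intro v u huv φ hφ hmem
  have h1 : ∀ j, j + 1 ≤ rk u → φ (j + 1) = 0 := by
    intro j hj
    ext W
    by_contra h0
    have := (hφ (j + 1) hj W h0).2.1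
    omega
  rw [Finset.sum_range_succ', ha.zero, Finset.sum_eq_zero, zero_add] at hmem
  · intro j hj
    cases j with
    | zero =>
      refine eq_zero_of_lam R (a := a) (fun W hW => ?_) (lam_diffSpan R hm hmem)
      obtain ⟨h2, h3, -⟩ := hφ 0 (by omega) W hW
      exact ⟨h2, by omega⟩
    | succ j => exact h1 j hj
  · intro j hj
    rw [Finset.mem_range] at hj
    rw [h1 j (by omega), map_zero, map_zero]

/-- The terms with positive index are governed by a single vector `M` attached to `u`. Comparison of
leading ranks shows that `M` is a combination of differences one rank lower, so the hypothesis in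
degree `i` removes these terms; the term of index `0` is then a combination of normal words with
value zero. -/
theorem indepMod_succ {i : ℕ} (hD : IndepMod rk a R i) : IndepMod rk a R (i + 1) := by
  classical
  intro v u huv φ hφ hmem
  have hvr := hrk.strictMono huv
  have hφ0 : IsNormalComb rk (i + 1) (φ 0) := fun W hW => by
    obtain ⟨h2, h3, -⟩ := hφ 0 (by omega) W hW
    exact ⟨h2, by omega⟩
  obtain ⟨d, hd, hd0, hd1⟩ := mem_diffSpan.1 hmem
  rw [Finset.sum_range_succ', ha.zero, Module.End.one_apply] at hd1
  by_cases h0 : rk u = 0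
  · have h1 : evalAt a R.one (φ 0) = 0 := by
      rw [h0, Finset.sum_range_zero, zero_add] at hd1
      rw [← hd1]
      refine Finset.sum_eq_zero fun t _ => ?_
      by_cases ht : rk t = 0
      · rw [R.g_bot t ht, LinearMap.zero_apply]
      · rw [hd t (fun h => ht (by rw [h.2, h0])), map_zero]
    intro j hj
    obtain rfl : j = 0 := by omega
    exact eq_zero_of_evalAt_eq_zero hrk ha R hX hm low hlow hD hφ0 h1
  have hy := hlow u h0
  have hyr := hrk.covBy hy
  set y := low u
  set M : V := ∑ j ∈ Finset.range (rk u), a y j (evalAt a R.one (φ (j + 1))) with hM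
  have hlead := sum_add_mem_lowSpan hrk ha hX hy (fun j => evalAt a R.one (φ (j + 1)))
  rw [← hM] at hlead
  -- Modulo lower rank, `a u (j + 1)` is `-g u 1` after `a y j`. Moving these terms to the other
  -- side adds `M` to the component of `d` at `u`.
  set d' : P → V := fun x => d x + Pi.single (M := fun _ => V) u M x with hd'
  have hsum' : ∑ x, R.g x 1 (d' x) = ∑ x, R.g x 1 (d x) + R.g u 1 M := by
    simp only [hd', map_add, Finset.sum_add_distrib]
    congr 1
    rw [Finset.sum_eq_single u] <;> simp +contextual
  have hd's : ∀ x, ¬ (x ≤ v ∧ rk x = rk u) → d' x = 0 := by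
    intro x hx
    have h1 : x ≠ u := by
      rintro rfl
      exact hx ⟨huv.le, rfl⟩
    simp [hd', hd x hx, h1]
  have hev : evalAt a R.one (φ 0) - ∑ x, R.g x 1 (d' x) ∈
      lowSpan rk (fun x => R.g x 1) (rk u - 1) := by
    rw [hsum', hd1, show rk u - 1 = rk y by omega]
    refine (neg_mem_iff (S := Submodule F V)).1 ?_
    convert hlead using 1
    abel
  have hhead := tailPart_eq_zero_of_mem_lowSpan hrk ha R hX hm low hlow hD hφ0 (rk u) (by
    rw [← sub_add_cancel (evalAt a R.one (φ 0)) (∑ x, R.g x 1 (d' x))]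
    refine add_mem (lowSpan_mono _ (by omega) hev) (Submodule.sum_mem _ fun x _ => ?_)
    by_cases hx : rk x = rk u
    · exact mem_lowSpan (X := fun x => R.g x 1) hx.le _
    · rw [hd's x (fun h => hx h.2), map_zero]
      exact zero_mem _)
  have hJ : ∀ x, rk x = rk u → d' x ∈ diffSpan (fun y => R.g y 1) {y | y ⋖ x} := by
    intro x hx
    by_cases hxv : x ≤ v
    · have h1 := leading_mem hrk ha R hX hm low hlow h0 hφ0 hhead
        (fun x hx => hd's x fun h => hx h.2) hev hx
      rwa [Finset.sum_eq_zero, zero_add] at h1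
      intro j _
      -- Words of `φ 0` cannot begin at an element below `v` of the rank of `u`, so only `d' x`
      -- survives in `leading_mem`.
      have h2 : tailPart (x, j + 1) (φ 0) = 0 := by
        ext W
        by_contra h3
        refine (hφ 0 (by omega) _ h3).2.2 ⟨hxv.lt_of_ne ?_, by omega⟩
        rintro rfl
        omega
      rw [h2, map_zero, map_zero]
    · rw [hd's x fun h => hxv h.1]
      exact zero_mem _
  have hMmem : M ∈ diffSpan (fun y => R.g y 1) {t | t ≤ v ∧ rk t = rk y} := by
    -- The family `d` has sum zero, so `M` is the total of `d'`, whose components are differences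
    -- below elements `x ≤ v`.
    have h1 : M = ∑ x, d' x := by
      simp [hd', Finset.sum_add_distrib, hd0]
    rw [h1]
    refine Submodule.sum_mem _ fun x _ => ?_
    by_cases hx : x ≤ v ∧ rk x = rk u
    · refine diffSpan_mono ?_ (hJ x hx.2)
      intro t ht
      have := hrk.covBy ht
      exact ⟨ht.le.trans hx.1, by omega⟩
    · rw [hd's x hx]
      exact zero_mem _
  have htail : ∀ j ≤ rk y, φ (j + 1) = 0 := by
    refine hD v y (hy.lt.trans huv) (fun j => φ (j + 1)) ?_ (by rwa [← hyr])
    intro j hj W hW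
    obtain ⟨h1, h2, h3⟩ := hφ (j + 1) (by omega) W hW
    refine ⟨h1, by omega, ?_⟩
    rwa [show rk y - j = rk u - (j + 1) by omega]
  have hM0 : M = 0 := by
    refine Finset.sum_eq_zero fun j hj => ?_
    rw [Finset.mem_range] at hj
    rw [htail j (by omega), map_zero, map_zero]
  have hdd : d' = d := by
    funext x
    simp [hd', hM0]
  rw [hdd] at hJ
  intro j hj
  cases j with
  | succ j => exact htail j (by omega)
  | zero =>
    refine eq_zero_of_evalAt_eq_zero hrk ha R hX hm low hlow hD hφ0 ?_
    rw [R.sum_eq_zero_of_mem hrk (rk u) (hm u) d (fun x hx => hd x fun h => hx h.2) hd0 hJ,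
      Finset.sum_eq_zero, zero_add] at hd1
    · exact hd1.symm
    · intro j hj
      rw [Finset.mem_range] at hj
      rw [htail j (by omega), map_zero, map_zero]

end

/-- The values of the normal words of a fixed degree are linearly independent. -/
theorem linearIndependent_normal (hrk : IsUniformRank rk) (ha : IsPathFamily rk a)
    (R : PathRep F rk m V) (hX : ∀ v, a v 1 = -R.g v 1) (hm : ∀ v, rk v ≤ m) (i : ℕ)
    (φ : List (P × ℕ) →₀ F) (hφ : IsNormalComb rk i φ) (h : evalAt a R.one φ = 0) : φ = 0 := by
  have hy : ∀ v, ∃ y, rk v ≠ 0 → y ⋖ v := by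
    intro v
    by_cases hv : rk v = 0
    · exact ⟨v, fun h => absurd hv h⟩
    · obtain ⟨y, hy⟩ := hrk.exists_covBy hv
      exact ⟨y, fun _ => hy⟩
  choose low hlow using hy
  have hD : ∀ i, IndepMod rk a R i := by
    intro i
    induction i with
    | zero => exact indepMod_zero ha R hm
    | succ i ih => exact indepMod_succ hrk ha R hX hm low hlow ih
  cases i with
  | zero => exact eq_zero_of_lam R (a := a) hφ (by rw [h, map_zero])
  | succ i => exact eq_zero_of_evalAt_eq_zero hrk ha R hX hm low hlow (hD i) hφ h

end Independence

end SplittingAlg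

/-! ### The action of the splitting algebra on a representation -/

namespace SplittingAlg

universe u v w

section Action

variable {F : Type u} [Field F] {P : Type v} [PartialOrder P] [Fintype P] {rk : P → ℕ} {m : ℕ}
  {V : Type w} [AddCommGroup V] [Module F V]

namespace PathRep

/-- The operators of a representation, extended by zero to negative indices. -/
def gInt (R : PathRep F rk m V) (x : P) (k : ℤ) : Module.End F V :=
  if 0 ≤ k then R.g x k.toNat else 0

theorem gInt_covBy (R : PathRep F rk m V) {x y : P} (h : x ⋖ y) (hy : rk y ≤ m) (k : ℤ) :
    R.gInt y (k + 1) - R.gInt y k * (R.g y 1 - R.g x 1) = R.gInt x (k + 1) := by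
  rcases lt_trichotomy k (-1) with hk | rfl | hk
  · simp [gInt, show ¬ 0 ≤ k + 1 by omega, show ¬ 0 ≤ k by omega]
  · simp [gInt, R.g_zero]
  · lift k to ℕ using by omega
    simp only [gInt, show (0 : ℤ) ≤ (k : ℤ) + 1 by omega, show (0 : ℤ) ≤ (k : ℤ) by omega, if_true]
    rw [show ((k : ℤ) + 1).toNat = k + 1 by omega, Int.toNat_natCast, R.g_covBy x y h hy,
      add_sub_cancel_right]

/-- The coefficient of index `j` of the product of the series of operators attached to `x` with a
polynomial in the inverse variable. -/
def pairing (R : PathRep F rk m V) (x : P) (j : ℤ) :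
    Polynomial (Module.End F V) →+ Module.End F V where
  toFun Q := Q.sum fun i q => R.gInt x (j + i) * q
  map_zero' := Polynomial.sum_zero_index _
  map_add' Q Q' := Polynomial.sum_add_index _ _ _ (by simp) (by simp [mul_add])

theorem pairing_monomial (R : PathRep F rk m V) (x : P) (j : ℤ) (i : ℕ) (q : Module.End F V) :
    R.pairing x j (Polynomial.monomial i q) = R.gInt x (j + i) * q :=
  Polynomial.sum_monomial_index _ _ (by simp)

theorem pairing_mul (R : PathRep F rk m V) {x y : P} (h : x ⋖ y) (hy : rk y ≤ m) (j : ℤ)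
    (Q : Polynomial (Module.End F V)) :
    R.pairing y j ((Polynomial.X - Polynomial.C (R.g y 1 - R.g x 1)) * Q) =
      R.pairing x (j + 1) Q := by
  induction Q using Polynomial.induction_on' with
  | add p q hp hq => rw [mul_add, map_add, map_add, hp, hq]
  | monomial i q =>
    rw [sub_mul, Polynomial.X_mul_monomial, Polynomial.C_mul_monomial, map_sub, pairing_monomial,
      pairing_monomial, pairing_monomial, ← mul_assoc, ← sub_mul,
      show j + ((i + 1 : ℕ) : ℤ) = j + i + 1 by push_cast; ring, R.gInt_covBy h hy,
      add_right_comm j 1 (i : ℤ)]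

/-- The polynomial of operators attached to a list of edges. -/
noncomputable def listPoly (R : PathRep F rk m V) (l : List (HasseEdge P)) :
    Polynomial (Module.End F V) :=
  (l.map fun e => Polynomial.X - Polynomial.C (R.g e.tail 1 - R.g e.head 1)).prod

/-- With $G_x=\sum_k g(x,k)t^{-k}$, one edge from $y$ to $x$ satisfies $G_y\,(t-e)=t\,G_x$. Along a
path of length $m$ this telescopes to $G_{tail}\prod_i(t-e_i)=t^mG_{head}$. -/
theorem pairing_listPoly (R : PathRep F rk m V) (hm : ∀ x, rk x ≤ m) (l : List (HasseEdge P))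
    (hl : l ≠ []) (hc : l.IsChain fun e f => e.head = f.tail) (j : ℤ) :
    R.pairing (l.head hl).tail j (R.listPoly l) = R.gInt (l.getLast hl).head (j + l.length) := by
  induction l generalizing j with
  | nil => exact absurd rfl hl
  | cons e l ih =>
    rw [listPoly, List.map_cons, List.prod_cons, List.head_cons, R.pairing_mul e.covBy (hm _)]
    cases l with
    | nil =>
      rw [List.map_nil, List.prod_nil, ← Polynomial.monomial_zero_one, pairing_monomial]
      simp
    | cons f l =>
      rw [List.isChain_cons_cons] at hc
      have := ih (by simp) hc.2 (j + 1)
      rw [List.head_cons, ← hc.1] at this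
      rw [List.getLast_cons (by simp)]
      rw [listPoly] at this
      rw [this, List.length_cons (a := e)]
      push_cast
      rw [add_right_comm, add_assoc]

/-- The series attached to `x` begins with `g x 0 = 1`, so its product with `Q` has the same leading
coefficient as `Q`. -/
theorem eq_zero_of_pairing (R : PathRep F rk m V) (x : P) {Q : Polynomial (Module.End F V)}
    (h : ∀ j, R.pairing x j Q = 0) : Q = 0 := by
  rw [← Polynomial.leadingCoeff_eq_zero]
  have h1 := h (-(Q.natDegree : ℤ))
  change Q.sum (fun i q => R.gInt x (-(Q.natDegree : ℤ) + i) * q) = 0 at h1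
  rw [Polynomial.sum_over_range _ (by simp), Finset.sum_range_succ, Finset.sum_eq_zero,
    zero_add] at h1
  · simpa [gInt, R.g_zero] using h1
  · intro i hi
    rw [Finset.mem_range] at hi
    simp only [gInt]
    rw [if_neg (by omega), zero_mul]

end PathRep

omit [Fintype P] in
theorem length_edges (hrk : IsUniformRank rk) (l : List (HasseEdge P)) (hl : l ≠ [])
    (hc : l.IsChain fun e f => e.head = f.tail) :
    rk (l.head hl).tail = rk (l.getLast hl).head + l.length := by
  induction l with
  | nil => exact absurd rfl hl
  | cons e l ih =>
    have h1 := hrk.covBy e.covBy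
    cases l with
    | nil => simpa using h1
    | cons f l =>
      rw [List.isChain_cons_cons] at hc
      have := ih (by simp) hc.2
      rw [List.head_cons, ← hc.1] at this
      rw [List.getLast_cons (by simp), List.head_cons, h1, this, List.length_cons (a := e)]
      omega

/-- The action of the splitting algebra on a representation. -/
noncomputable def PathRep.action (hrk : IsUniformRank rk) (R : PathRep F rk m V)
    (hm : ∀ x, rk x ≤ m) : SplittingAlgebra F P →ₐ[F] Module.End F V :=
  RingQuot.liftAlgHom F ⟨FreeAlgebra.lift F fun e => R.g e.tail 1 - R.g e.head 1, by
    rintro _ _ ⟨π₁, π₂, ht, hh, i⟩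
    have h : ∀ π : HassePath P, FreeAlgebra.lift F (fun e : HasseEdge P =>
        R.g e.tail 1 - R.g e.head 1) ((π.poly F).coeff i) = (R.listPoly π.edges).coeff i := by
      intro π
      have h1 : (π.poly F).map (FreeAlgebra.lift F (fun e : HasseEdge P =>
          R.g e.tail 1 - R.g e.head 1)).toRingHom = R.listPoly π.edges := by
        unfold HassePath.poly PathRep.listPoly
        rw [← Polynomial.coe_mapRingHom, map_list_prod, List.map_map]
        congr 1
        apply List.map_congr_left
        intro e _
        simp
      rw [← h1, Polynomial.coeff_map]
      rfl
    rw [h, h]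
    congr 1
    rw [← sub_eq_zero]
    -- Both path polynomials carry the series of the common tail to the series of the common head,
    -- shifted by the path length, which the ranks determine. The series of the tail can be
    -- cancelled.
    refine R.eq_zero_of_pairing π₁.tail fun j => ?_
    have h1 := R.pairing_listPoly hm π₁.edges π₁.ne_nil π₁.isChain j
    have h2 := R.pairing_listPoly hm π₂.edges π₂.ne_nil π₂.isChain j
    have h3 := length_edges hrk π₁.edges π₁.ne_nil π₁.isChain
    have h4 := length_edges hrk π₂.edges π₂.ne_nil π₂.isChain
    unfold HassePath.tail at ht
    unfold HassePath.head at hh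
    have h5 : π₁.edges.length = π₂.edges.length := by
      rw [ht, hh] at h3
      omega
    rw [map_sub, HassePath.tail, h1, ht, h2, hh, h5, sub_self]⟩

theorem PathRep.action_edgeClass (hrk : IsUniformRank rk) (R : PathRep F rk m V)
    (hm : ∀ x, rk x ≤ m) (e : HasseEdge P) :
    R.action hrk hm (edgeClass F e) = R.g e.tail 1 - R.g e.head 1 := by
  simp [PathRep.action, edgeClass]

end Action

/-! ### Vertex polynomials and the recursion for their coefficients -/

section VertexPoly

variable (F : Type u) [Field F] {P : Type v} [PartialOrder P] {rk : P → ℕ}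

/-- The polynomial of a path, with coefficients in the splitting algebra. -/
noncomputable def HassePath.classPoly (π : HassePath P) : Polynomial (SplittingAlgebra F P) :=
  (π.edges.map fun e => Polynomial.X - Polynomial.C (edgeClass F e)).prod

theorem HassePath.classPoly_eq {π₁ π₂ : HassePath P} (ht : π₁.tail = π₂.tail)
    (hh : π₁.head = π₂.head) : π₁.classPoly F = π₂.classPoly F := by
  have h : ∀ π : HassePath P, π.classPoly F =
      (π.poly F).map (RingQuot.mkAlgHom F (SplittingRel F P)).toRingHom := by
    intro π
    unfold HassePath.poly HassePath.classPoly
    rw [← Polynomial.coe_mapRingHom, map_list_prod, List.map_map]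
    congr 1
    apply List.map_congr_left
    intro e _
    rw [Function.comp_apply, Polynomial.coe_mapRingHom, Polynomial.map_sub, Polynomial.map_X,
      Polynomial.map_C]
    rfl
  rw [h, h]
  ext i
  rw [Polynomial.coeff_map, Polynomial.coeff_map]
  exact RingQuot.mkAlgHom_rel F (SplittingRel.coeff π₁ π₂ ht hh i)

open Classical in
variable (rk) in
/-- The polynomial of any path from `v` to the element of rank zero. -/
noncomputable def vertexPoly (v : P) : Polynomial (SplittingAlgebra F P) :=
  if h : ∃ π : HassePath P, π.tail = v ∧ rk π.head = 0 then h.choose.classPoly F else 1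

theorem vertexPoly_eq (hrk : IsUniformRank rk) (π : HassePath P) (h : rk π.head = 0) :
    vertexPoly F rk π.tail = π.classPoly F := by
  have h1 : ∃ π' : HassePath P, π'.tail = π.tail ∧ rk π'.head = 0 := ⟨π, rfl, h⟩
  rw [vertexPoly, dif_pos h1]
  exact HassePath.classPoly_eq F h1.choose_spec.1 (hrk.unique_zero h1.choose_spec.2 h)

theorem vertexPoly_of_rank_eq_zero (hrk : IsUniformRank rk) {v : P} (h : rk v = 0) :
    vertexPoly F rk v = 1 := by
  rw [vertexPoly, dif_neg]
  rintro ⟨π, rfl, -⟩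
  have := hrk.covBy (π.edges.head π.ne_nil).covBy
  rw [HassePath.tail] at h
  omega

theorem exists_path (hrk : IsUniformRank rk) (v : P) (h : rk v ≠ 0) :
    ∃ π : HassePath P, π.tail = v ∧ rk π.head = 0 := by
  induction hn : rk v using Nat.strong_induction_on generalizing v with
  | _ n ih =>
    subst hn
    obtain ⟨y, hy⟩ := hrk.exists_covBy h
    have h1 := hrk.covBy hy
    by_cases h0 : rk y = 0
    · exact ⟨⟨[⟨v, y, hy⟩], by simp, by simp⟩, rfl, h0⟩
    · obtain ⟨π, h2, h3⟩ := ih (rk y) (by omega) y h0 rfl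
      refine ⟨⟨⟨v, y, hy⟩ :: π.edges, by simp, ?_⟩, rfl, ?_⟩
      · rw [← List.cons_head_tail π.ne_nil, List.isChain_cons_cons, List.cons_head_tail]
        exact ⟨h2.symm, π.isChain⟩
      · rw [HassePath.head, List.getLast_cons π.ne_nil]
        exact h3

theorem vertexPoly_covBy (hrk : IsUniformRank rk) (e : HasseEdge P) :
    vertexPoly F rk e.tail =
      (Polynomial.X - Polynomial.C (edgeClass F e)) * vertexPoly F rk e.head := by
  by_cases h0 : rk e.head = 0
  · rw [vertexPoly_of_rank_eq_zero F hrk h0]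
    have := vertexPoly_eq F hrk ⟨[e], by simp, by simp⟩ h0
    simpa [HassePath.classPoly, HassePath.tail] using this
  · obtain ⟨π, h2, h3⟩ := exists_path hrk e.head h0
    have h := vertexPoly_eq F hrk ⟨e :: π.edges, by simp, by
      rw [← List.cons_head_tail π.ne_nil, List.isChain_cons_cons, List.cons_head_tail]
      exact ⟨h2.symm, π.isChain⟩⟩ (by
        rw [HassePath.head, List.getLast_cons π.ne_nil]
        exact h3)
    rw [← h2, vertexPoly_eq F hrk π h3]
    simpa [HassePath.classPoly, HassePath.tail] using h

theorem coeff_X_sub_C_mul_succ {A : Type*} [Ring A] (e : A) (Q : Polynomial A) (j : ℕ) :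
    ((Polynomial.X - Polynomial.C e) * Q).coeff (j + 1) = Q.coeff j - e * Q.coeff (j + 1) := by
  rw [sub_mul, Polynomial.coeff_sub, Polynomial.coeff_X_mul, Polynomial.coeff_C_mul]

theorem coeff_X_sub_C_mul_zero {A : Type*} [Ring A] (e : A) (Q : Polynomial A) :
    ((Polynomial.X - Polynomial.C e) * Q).coeff 0 = 0 - e * Q.coeff 0 := by
  rw [sub_mul, Polynomial.coeff_sub, Polynomial.coeff_C_mul, Polynomial.coeff_X_mul_zero]

theorem coeff_vertexPoly (hrk : IsUniformRank rk) (v : P) :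
    (vertexPoly F rk v).coeff (rk v) = 1 ∧ ∀ j, rk v < j → (vertexPoly F rk v).coeff j = 0 := by
  induction hn : rk v using Nat.strong_induction_on generalizing v with
  | _ n ih =>
    subst hn
    by_cases h0 : rk v = 0
    · rw [vertexPoly_of_rank_eq_zero F hrk h0, h0]
      refine ⟨by simp, fun j hj => ?_⟩
      rw [Polynomial.coeff_one, if_neg (by omega)]
    · obtain ⟨y, hy⟩ := hrk.exists_covBy h0
      have h1 := hrk.covBy hy
      obtain ⟨h2, h3⟩ := ih (rk y) (by omega) y rfl
      have h4 := vertexPoly_covBy F hrk ⟨v, y, hy⟩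
      simp only at h4
      rw [h4]
      constructor
      · rw [h1, coeff_X_sub_C_mul_succ, h2, h3 _ (by omega), mul_zero, sub_zero]
      · intro j hj
        obtain ⟨j, rfl⟩ : ∃ j', j = j' + 1 := ⟨j - 1, by omega⟩
        rw [coeff_X_sub_C_mul_succ, h3 _ (by omega), h3 _ (by omega), mul_zero, sub_zero]

variable (rk) in
/-- The coefficients of the polynomial of a vertex, in descending order. -/
noncomputable def vertexCoeff (v : P) (k : ℕ) : SplittingAlgebra F P :=
  if k ≤ rk v then (vertexPoly F rk v).coeff (rk v - k) else 0

theorem vertexCoeff_zero (hrk : IsUniformRank rk) (v : P) : vertexCoeff F rk v 0 = 1 := by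
  rw [vertexCoeff, if_pos (Nat.zero_le _), Nat.sub_zero, (coeff_vertexPoly F hrk v).1]

theorem vertexCoeff_of_lt (v : P) (k : ℕ) (h : rk v < k) : vertexCoeff F rk v k = 0 := by
  rw [vertexCoeff, if_neg (by omega)]

theorem vertexCoeff_succ (hrk : IsUniformRank rk) (e : HasseEdge P) (k : ℕ) :
    vertexCoeff F rk e.tail (k + 1) =
      vertexCoeff F rk e.head (k + 1) - edgeClass F e * vertexCoeff F rk e.head k := by
  have h1 := hrk.covBy e.covBy
  rcases lt_trichotomy k (rk e.head) with hk | hk | hk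
  · rw [vertexCoeff, vertexCoeff, vertexCoeff, if_pos (by omega), if_pos (by omega),
      if_pos (by omega), vertexPoly_covBy F hrk e]
    obtain ⟨j, hj⟩ : ∃ j, rk e.head = k + 1 + j := ⟨rk e.head - (k + 1), by omega⟩
    rw [show rk e.tail - (k + 1) = j + 1 by omega, show rk e.head - (k + 1) = j by omega,
      show rk e.head - k = j + 1 by omega, coeff_X_sub_C_mul_succ]
  -- This is the constant term of the polynomial of the tail: multiplication by $t$ contributes
  -- nothing, in agreement with the convention that coefficients of index above the rank are zero.
  · rw [vertexCoeff, vertexCoeff, vertexCoeff, if_pos (by omega), if_neg (by omega),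
      if_pos (by omega), vertexPoly_covBy F hrk e,
      show rk e.tail - (k + 1) = 0 by omega, show rk e.head - k = 0 by omega, coeff_X_sub_C_mul_zero]
  · rw [vertexCoeff_of_lt, vertexCoeff_of_lt, vertexCoeff_of_lt, mul_zero, sub_zero] <;> omega

theorem edgeClass_eq (hrk : IsUniformRank rk) (e : HasseEdge P) :
    edgeClass F e = vertexCoeff F rk e.head 1 - vertexCoeff F rk e.tail 1 := by
  rw [vertexCoeff_succ F hrk e, vertexCoeff_zero F hrk, mul_one, sub_sub_cancel]

theorem eq_add_sub_mul {A : Type*} [Ring A] {x y z e b c : A} (h1 : x = y - e * z)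
    (h2 : e = b - c) : x = y + (c - b) * z := by
  rw [h1, h2]
  noncomm_ring

theorem isPathFamily_vertexCoeff (hrk : IsUniformRank rk) :
    IsPathFamily rk (vertexCoeff F rk : P → ℕ → SplittingAlgebra F P) where
  zero := vertexCoeff_zero F hrk
  eq_zero := vertexCoeff_of_lt F
  covBy y v hy k := by
    have h1 := vertexCoeff_succ F hrk ⟨v, y, hy⟩ k
    have h2 := edgeClass_eq F hrk ⟨v, y, hy⟩
    exact eq_add_sub_mul h1 h2

/-- Induction along the recursion that determines the coefficients. -/
theorem vertexCoeff_induction (hrk : IsUniformRank rk) {p : P → ℕ → Prop} (h0 : ∀ v, p v 0)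
    (h1 : ∀ v k, rk v < k → p v k)
    (h2 : ∀ (e : HasseEdge P) k, p e.head (k + 1) → p e.head k → p e.tail (k + 1)) (v : P) (k : ℕ) :
    p v k := by
  induction hn : rk v using Nat.strong_induction_on generalizing v k with
  | _ n ih =>
    subst hn
    cases k with
    | zero => exact h0 v
    | succ k =>
      by_cases hv : rk v = 0
      · exact h1 v _ (by omega)
      · obtain ⟨y, hy⟩ := hrk.exists_covBy hv
        have h3 := hrk.covBy hy
        exact h2 ⟨v, y, hy⟩ k (ih (rk y) (by omega) y _ rfl) (ih (rk y) (by omega) y _ rfl)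

theorem inducedMap_vertexCoeff (hrk : IsUniformRank rk) (σ : P ≃o P) (hσ : ∀ v, rk (σ v) = rk v)
    (v : P) (k : ℕ) : inducedMap F σ (vertexCoeff F rk v k) = vertexCoeff F rk (σ v) k := by
  induction v, k using vertexCoeff_induction hrk with
  | h0 v => rw [vertexCoeff_zero F hrk, vertexCoeff_zero F hrk, map_one]
  | h1 v k h =>
    rw [vertexCoeff_of_lt F v k h, vertexCoeff_of_lt F (σ v) k (by rwa [hσ]), map_zero]
  | h2 e k ih1 ih2 =>
    have := vertexCoeff_succ F hrk (e.map σ) k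
    rw [vertexCoeff_succ F hrk e, map_sub, map_mul, ih1, ih2, inducedMap_edgeClass]
    exact this.symm

theorem vertexCoeff_mem_gradedPiece (hrk : IsUniformRank rk) (v : P) (k : ℕ) :
    vertexCoeff F rk v k ∈ gradedPiece F P k := by
  induction v, k using vertexCoeff_induction hrk with
  | h0 v =>
    rw [vertexCoeff_zero F hrk, gradedPiece, pow_zero]
    exact Submodule.one_le.1 le_rfl
  | h1 v k h =>
    rw [vertexCoeff_of_lt F v k h]
    exact zero_mem _
  | h2 e k ih1 ih2 =>
    rw [vertexCoeff_succ F hrk e]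
    refine sub_mem ih1 ?_
    rw [gradedPiece, pow_succ']
    exact Submodule.mul_mem_mul (Submodule.subset_span ⟨e, rfl⟩) ih2

theorem wval_mem_gradedPiece (hrk : IsUniformRank rk) (W : List (P × ℕ)) :
    wval (vertexCoeff F rk) W ∈ gradedPiece F P (wdeg W) := by
  induction W with
  | nil =>
    rw [wval_nil, wdeg_nil, gradedPiece, pow_zero]
    exact Submodule.one_le.1 le_rfl
  | cons l W ih =>
    obtain ⟨v, k⟩ := l
    rw [wval_cons, wdeg_cons, gradedPiece, pow_add]
    exact Submodule.mul_mem_mul (vertexCoeff_mem_gradedPiece F hrk v k) ih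

theorem gradedPiece_eq_normalSpan [Finite P] (hrk : IsUniformRank rk) (i : ℕ) :
    gradedPiece F P i = normalSpan F rk (vertexCoeff F rk) i := by
  apply le_antisymm
  · induction i with
    | zero =>
      rw [gradedPiece, pow_zero, Submodule.one_le]
      exact Submodule.subset_span ⟨[], trivial, rfl, rfl⟩
    | succ i ih =>
      rw [gradedPiece, pow_succ', Submodule.mul_le]
      intro x hx y hy
      induction hx using Submodule.span_induction with
      | mem x hx =>
        obtain ⟨e, rfl⟩ := hx
        rw [edgeClass_eq F hrk, sub_mul]
        exact sub_mem (mul_normalSpan_mem hrk (isPathFamily_vertexCoeff F hrk) _ i (ih hy))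
          (mul_normalSpan_mem hrk (isPathFamily_vertexCoeff F hrk) _ i (ih hy))
      | zero => rw [zero_mul]; exact zero_mem _
      | add a b _ _ h1 h2 => rw [add_mul]; exact add_mem h1 h2
      | smul r a _ h => rw [smul_mul_assoc]; exact Submodule.smul_mem _ r h
  · refine Submodule.span_le.2 ?_
    rintro _ ⟨W, -, rfl, rfl⟩
    exact wval_mem_gradedPiece F hrk W

end VertexPoly

/-! ### The trace as a number of fixed words -/

section Trace

variable (F : Type u) [Field F] {P : Type} [PartialOrder P] [Fintype P] {rk : P → ℕ}

/-- It suffices to prove independence after acting on the vector `one` of a representation covering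
all ranks of the finite poset. -/
theorem linearIndependent_wval (hrk : IsUniformRank rk) (i : ℕ) :
    LinearIndependent F fun W : {W : List (P × ℕ) // IsNormal rk W ∧ wdeg W = i} =>
      wval (vertexCoeff F rk) W.1 := by
  obtain ⟨m, hm⟩ : ∃ m, ∀ v : P, rk v ≤ m :=
    ⟨Finset.univ.sup rk, fun v => Finset.le_sup (Finset.mem_univ v)⟩
  obtain ⟨V, _, _, ⟨R⟩⟩ := exists_pathRep F hrk m
  set ρ := R.action hrk hm
  let a : P → ℕ → Module.End F V := fun v k => ρ (vertexCoeff F rk v k)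
  have hA := isPathFamily_vertexCoeff F hrk
  have ha : IsPathFamily rk a :=
    { zero := fun v => by simp only [a]; rw [hA.zero, map_one]
      eq_zero := fun v k h => by simp only [a]; rw [hA.eq_zero v k h, map_zero]
      covBy := fun y v h k => by
        simp only [a]
        rw [hA.covBy y v h, map_add, map_mul, map_sub] }
  -- An edge is `a y 1 - a v 1` and acts as `g v 1 - g y 1`, so `a v 1 + g v 1` is constant along
  -- covers; it vanishes in rank zero.
  have hX : ∀ v, a v 1 = -R.g v 1 := by
    intro v
    induction hn : rk v using Nat.strong_induction_on generalizing v with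
    | _ n ih =>
      subst hn
      by_cases h0 : rk v = 0
      · rw [ha.eq_zero v 1 (by omega), R.g_bot v h0, neg_zero]
      · obtain ⟨y, hy⟩ := hrk.exists_covBy h0
        have h1 := hrk.covBy hy
        have h2 := R.action_edgeClass hrk hm ⟨v, y, hy⟩
        rw [edgeClass_eq F hrk, map_sub] at h2
        have h3 := ih (rk y) (by omega) y rfl
        change a y 1 - a v 1 = R.g v 1 - R.g y 1 at h2
        rw [h3] at h2
        have h4 : a v 1 = -R.g y 1 - (-R.g y 1 - a v 1) := (sub_sub_cancel _ _).symm
        rw [h4, h2]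
        abel
  have hval : ∀ W, wval a W = ρ (wval (vertexCoeff F rk) W) := by
    intro W
    simp only [wval]
    rw [map_list_prod, List.map_map]
    rfl
  rw [linearIndependent_iff]
  intro l hl
  have h1 := linearIndependent_normal hrk ha R hX hm i (l.mapDomain Subtype.val) ?_ ?_
  · exact Finsupp.mapDomain_injective Subtype.val_injective (by rw [h1, Finsupp.mapDomain_zero])
  · intro W hW
    by_contra h
    refine hW (Finsupp.mapDomain_of_notMem_range _ _ ?_)
    rintro ⟨W', rfl⟩
    exact h W'.2
  · rw [evalAt, Finsupp.linearCombination_mapDomain]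
    have h2 := congrArg (fun x => ρ x R.one) hl
    simp only [map_zero, LinearMap.zero_apply] at h2
    rw [← h2, Finsupp.linearCombination_apply, Finsupp.linearCombination_apply, Finsupp.sum,
      Finsupp.sum, map_sum, LinearMap.sum_apply]
    refine Finset.sum_congr rfl fun W _ => ?_
    rw [map_smul, LinearMap.smul_apply, Function.comp_apply, hval]

variable (rk) in
theorem finite_normal (i : ℕ) : {W : List (P × ℕ) | IsNormal rk W ∧ wdeg W = i}.Finite := by
  induction i using Nat.strong_induction_on with
  | _ i ih =>
    have : {W : List (P × ℕ) | IsNormal rk W ∧ wdeg W = i} ⊆ {[]} ∪ ⋃ v : P,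
        ⋃ k ∈ Set.Icc 1 i, (List.cons (v, k)) '' {W | IsNormal rk W ∧ wdeg W = i - k} := by
      rintro W ⟨h1, h2⟩
      match W with
      | [] => exact Or.inl rfl
      | (v, k) :: W =>
        obtain ⟨⟨h3, h4⟩, -, h5⟩ := h1
        rw [wdeg_cons] at h2
        refine Or.inr ?_
        simp only [Set.mem_iUnion]
        exact ⟨v, k, ⟨h3, by omega⟩, W, ⟨h5, by omega⟩, rfl⟩
    refine Set.Finite.subset ((Set.finite_singleton _).union (Set.finite_iUnion fun v =>
      (Set.finite_Icc 1 i).biUnion fun k hk => (ih (i - k) ?_).image _)) this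
    have := hk.1
    have := hk.2
    omega

/-- The action of an order automorphism on words. -/
def wmap (σ : P ≃o P) (W : List (P × ℕ)) : List (P × ℕ) := W.map fun l => (σ l.1, l.2)

omit [Fintype P] in
theorem wdeg_wmap (σ : P ≃o P) (W : List (P × ℕ)) : wdeg (wmap σ W) = wdeg W := by
  simp [wdeg, wmap, Function.comp_def]

omit [Fintype P] in
theorem isNormal_wmap {σ : P ≃o P} (hσ : ∀ v, rk (σ v) = rk v) {W : List (P × ℕ)}
    (h : IsNormal rk W) : IsNormal rk (wmap σ W) := by
  induction W with
  | nil => trivial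
  | cons l W ih =>
    obtain ⟨v, k⟩ := l
    obtain ⟨h1, h2, h3⟩ := h
    refine ⟨by simpa [hσ] using h1, ?_, ih h3⟩
    match W, h2 with
    | [], _ => exact fun h => h
    | (u, l) :: W, h2 =>
      rintro ⟨h4, h5⟩
      refine h2 ⟨σ.lt_iff_lt.1 h4, ?_⟩
      simpa [hσ] using h5

/-- The automorphism sends the coefficient of `v` to that of `σ v`, hence permutes the basis of
normal words; a permutation matrix has as many ones on its diagonal as there are fixed points. -/
theorem coeff_gradedTrace (hrk : IsUniformRank rk) {σ : P ≃o P} (hσ : ∀ v, rk (σ v) = rk v)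
    (i : ℕ) : PowerSeries.coeff i (gradedTrace F σ) =
      (({W : List (P × ℕ) | IsNormal rk W ∧ wdeg W = i ∧ wmap σ W = W}.ncard : ℕ) : F) := by
  classical
  set ι := {W : List (P × ℕ) // IsNormal rk W ∧ wdeg W = i} with hι
  have : Finite ι := finite_normal rk i
  have : Fintype ι := Fintype.ofFinite ι
  have hli := linearIndependent_wval F hrk i
  let f : ι → gradedPiece F P i := fun W =>
    ⟨wval (vertexCoeff F rk) W.1, by
      have := wval_mem_gradedPiece F hrk W.1
      rwa [W.2.2] at this⟩
  have hf : LinearIndependent F f :=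
    LinearIndependent.of_comp (gradedPiece F P i).subtype hli
  have hspan : ⊤ ≤ Submodule.span F (Set.range f) := by
    rw [← Submodule.map_le_map_iff_of_injective (gradedPiece F P i).injective_subtype,
      Submodule.map_span, Submodule.map_top, Submodule.range_subtype]
    refine (gradedPiece_eq_normalSpan F hrk i).le.trans (Submodule.span_mono ?_)
    rintro _ ⟨W, h1, h2, rfl⟩
    exact ⟨f ⟨W, h1, h2⟩, ⟨_, rfl⟩, rfl⟩
  let b := Module.Basis.mk hf hspan
  let s : ι → ι := fun W => ⟨wmap σ W.1, isNormal_wmap hσ W.2.1, by rw [wdeg_wmap, W.2.2]⟩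
  rw [gradedTrace, PowerSeries.coeff_mk, LinearMap.trace_eq_matrix_trace F b, Matrix.trace]
  have hdiag : ∀ W : ι, (LinearMap.toMatrix b b ((inducedMap F σ).toLinearMap.restrict
      (inducedMap_mem_gradedPiece F σ i))).diag W = if s W = W then 1 else 0 := by
    intro W
    rw [Matrix.diag_apply, LinearMap.toMatrix_apply]
    have h1 : ((inducedMap F σ).toLinearMap.restrict (inducedMap_mem_gradedPiece F σ i)) (b W) =
        b (s W) := by
      apply Subtype.ext
      simp only [b, Module.Basis.mk_apply, LinearMap.coe_restrict_apply, f, s, wval, wmap,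
        AlgHom.toLinearMap_apply]
      rw [map_list_prod, List.map_map, List.map_map]
      congr 1
      apply List.map_congr_left
      intro l _
      exact inducedMap_vertexCoeff F hrk σ hσ _ _
    rw [h1, Module.Basis.repr_self, Finsupp.single_apply]
  rw [Finset.sum_congr rfl fun W _ => hdiag W, Finset.sum_boole]
  congr 1
  rw [← Set.ncard_coe_finset, ← Set.ncard_image_of_injective _ Subtype.val_injective]
  congr 1
  ext W
  simp only [Finset.coe_filter, Finset.mem_univ, true_and, Set.mem_image, Set.mem_ofPred_eq, s]
  constructor
  · rintro ⟨W, h, rfl⟩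
    exact ⟨W.2.1, W.2.2, congrArg Subtype.val h⟩
  · rintro ⟨h1, h2, h3⟩
    exact ⟨⟨W, h1, h2⟩, Subtype.ext h3, rfl⟩

end Trace

end SplittingAlg

/-! ### Generating functions of fixed words -/

namespace SplittingAlg

universe u

section Counting

open Classical in
/-- The normal words of degree `i` that are fixed by `σ`. -/
noncomputable def fixedWords {P : Type} [PartialOrder P] [Fintype P] (rk : P → ℕ) (σ : P ≃o P)
    (i : ℕ) : Finset (List (P × ℕ)) :=
  (finite_normal rk i).toFinset.filter fun W => wmap σ W = W

variable {P : Type} [PartialOrder P] [Fintype P] {rk : P → ℕ} {σ : P ≃o P}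

theorem mem_fixedWords {i : ℕ} {W : List (P × ℕ)} :
    W ∈ fixedWords rk σ i ↔ (IsNormal rk W ∧ wdeg W = i) ∧ wmap σ W = W := by
  simp [fixedWords]

theorem cons_mem_fixedWords {i : ℕ} {v : P} {k : ℕ} {W : List (P × ℕ)} :
    (v, k) :: W ∈ fixedWords rk σ i ↔ σ v = v ∧ (1 ≤ k ∧ k ≤ rk v) ∧ k ≤ i ∧
      ¬ HeadBelow rk v (rk v - k) W ∧ W ∈ fixedWords rk σ (i - k) := by
  rw [mem_fixedWords, mem_fixedWords, isNormal_cons, wdeg_cons]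
  simp only [wmap, List.map_cons, List.cons.injEq, Prod.mk.injEq, and_true]
  constructor
  · rintro ⟨⟨⟨h1, h2, h3⟩, h4⟩, h5, h6⟩
    exact ⟨h5, h1, by omega, h2, ⟨h3, by omega⟩, h6⟩
  · rintro ⟨h5, h1, h7, h2, ⟨h3, h4⟩, h6⟩
    exact ⟨⟨⟨h1, h2, h3⟩, by omega⟩, h5, h6⟩

variable [DecidableEq P]

variable (rk σ) in
/-- The number of fixed normal words of degree `i` that begin with a letter of `v`. -/
noncomputable def headCount (v : P) (i : ℕ) : ℕ :=
  ((fixedWords rk σ i).filter fun W => W.head?.map Prod.fst = some v).card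

theorem card_fixedWords (i : ℕ) :
    (fixedWords rk σ i).card = (if i = 0 then 1 else 0) + ∑ v, headCount rk σ v i := by
  rw [Finset.card_eq_sum_card_fiberwise (f := fun W => W.head?.map Prod.fst)
    (t := Finset.univ) (fun _ _ => Finset.mem_coe.2 (Finset.mem_univ _)), Fintype.sum_option]
  congr 1
  have h : ∀ W : List (P × ℕ), W.head?.map Prod.fst = none ↔ W = [] := by
    intro W
    cases W <;> simp
  simp only [h]
  have h1 : ([] : List (P × ℕ)) ∈ fixedWords rk σ i ↔ i = 0 := by
    rw [mem_fixedWords]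
    simp [IsNormal, wmap, eq_comm]
  have h2 : (fixedWords rk σ i).filter (fun W => W = []) = if i = 0 then {[]} else ∅ := by
    ext W
    split_ifs with hi
    · simp only [Finset.mem_filter, Finset.mem_singleton]
      exact ⟨fun h => h.2, fun h => ⟨h ▸ h1.2 hi, h⟩⟩
    · simp only [Finset.mem_filter, Finset.notMem_empty, iff_false]
      exact fun h => hi (h1.1 (h.2 ▸ h.1))
  rw [h2]
  split_ifs <;> rfl

open Classical in
theorem card_not_headBelow (v : P) (r i : ℕ) :
    ((fixedWords rk σ i).filter fun W => ¬ HeadBelow rk v r W).card +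
      ∑ u with u < v ∧ rk u = r, headCount rk σ u i = (fixedWords rk σ i).card := by
  rw [← Finset.card_filter_add_card_filter_not (s := fixedWords rk σ i)
    (fun W => HeadBelow rk v r W), add_comm]
  congr 1
  have h : ∀ W ∈ (fixedWords rk σ i).filter (fun W => HeadBelow rk v r W),
      W.head?.map Prod.fst ∈ (Finset.univ.filter fun u => u < v ∧ rk u = r).image some := by
    intro W hW
    obtain ⟨-, h⟩ := Finset.mem_filter.1 hW
    match W, h with
    | (u, _) :: _, h => simpa using (show u < v ∧ rk u = r from h)
  rw [Finset.card_eq_sum_card_fiberwise h, Finset.sum_image (by simp)]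
  refine Finset.sum_congr rfl fun u hu => ?_
  rw [headCount, Finset.filter_filter]
  congr 1
  ext W
  simp only [Finset.mem_filter]
  refine and_congr_right fun _ => ⟨fun h => ⟨?_, h⟩, fun h => h.2⟩
  match W, h with
  | (u', _) :: _, h =>
    obtain rfl : u' = u := by simpa using h
    exact (Finset.mem_filter.1 hu).2

open Classical in
-- Removing the first letter `(v, k)` is a bijection onto the fixed words of degree `i - k` that may
-- follow it.
theorem headCount_eq {v : P} (hv : σ v = v) (i : ℕ) :
    headCount rk σ v i = ∑ k ∈ Finset.Icc 1 (rk v), if k ≤ i then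
      ((fixedWords rk σ (i - k)).filter fun W => ¬ HeadBelow rk v (rk v - k) W).card else 0 := by
  have h : ∀ W ∈ (fixedWords rk σ i).filter (fun W => W.head?.map Prod.fst = some v),
      W.head?.map Prod.snd ∈ (Finset.Icc 1 (rk v)).image some := by
    intro W hW
    obtain ⟨h1, h2⟩ := Finset.mem_filter.1 hW
    match W, h2 with
    | (u, k) :: W, h2 =>
      obtain rfl : u = v := by simpa using h2
      obtain ⟨-, h3, -⟩ := cons_mem_fixedWords.1 h1
      simpa using h3
  rw [headCount, Finset.card_eq_sum_card_fiberwise h, Finset.sum_image (by simp)]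
  refine Finset.sum_congr rfl fun k hk => ?_
  rw [Finset.mem_Icc] at hk
  split_ifs with hki
  · rw [← Finset.card_image_of_injective ((fixedWords rk σ (i - k)).filter
      fun W => ¬ HeadBelow rk v (rk v - k) W) (List.cons_injective (a := (v, k)))]
    congr 1
    ext W
    simp only [Finset.mem_filter, Finset.mem_image]
    constructor
    · rintro ⟨⟨h1, h2⟩, h3⟩
      match W, h1, h2, h3 with
      | (u, l) :: W, h1, h2, h3 =>
        obtain rfl : u = v := by simpa using h2
        obtain rfl : l = k := by simpa using h3
        obtain ⟨-, -, -, h4, h5⟩ := cons_mem_fixedWords.1 h1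
        exact ⟨W, ⟨h5, h4⟩, rfl⟩
    · rintro ⟨W', ⟨h5, h4⟩, rfl⟩
      exact ⟨⟨cons_mem_fixedWords.2 ⟨hv, hk, hki, h4, h5⟩, rfl⟩, rfl⟩
  · rw [Finset.card_eq_zero, Finset.filter_eq_empty_iff]
    intro W hW h3
    obtain ⟨h1, h2⟩ := Finset.mem_filter.1 hW
    match W, h2, h3 with
    | (u, l) :: W, h2, h3 =>
      obtain rfl : l = k := by simpa using h3
      exact hki (cons_mem_fixedWords.1 h1).2.2.1

theorem headCount_of_ne {v : P} (hv : σ v ≠ v) (i : ℕ) : headCount rk σ v i = 0 := by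
  rw [headCount, Finset.card_eq_zero, Finset.filter_eq_empty_iff]
  intro W hW h2
  match W, h2 with
  | (u, k) :: W, h2 =>
    obtain rfl : u = v := by simpa using h2
    exact hv (cons_mem_fixedWords.1 hW).1

variable (F : Type u) [Field F]

variable (rk σ) in
/-- The generating function of the numbers `headCount`. -/
noncomputable def headSeries (v : P) : PowerSeries F :=
  PowerSeries.mk fun i => (headCount rk σ v i : F)

variable (rk σ) in
/-- The generating function of the numbers of fixed normal words. -/
noncomputable def fixedSeries : PowerSeries F :=
  PowerSeries.mk fun i => ((fixedWords rk σ i).card : F)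

theorem fixedSeries_eq : fixedSeries rk σ F = 1 + ∑ v, headSeries rk σ F v := by
  ext i
  rw [map_add, map_sum, PowerSeries.coeff_one, fixedSeries, PowerSeries.coeff_mk, card_fixedWords]
  simp [headSeries]

theorem headSeries_of_ne {v : P} (hv : σ v ≠ v) : headSeries rk σ F v = 0 := by
  ext i
  simp [headSeries, headCount_of_ne hv]

open Classical in
theorem headSeries_eq {v : P} (hv : σ v = v) :
    headSeries rk σ F v = ∑ k ∈ Finset.Icc 1 (rk v), PowerSeries.X ^ k *
      (fixedSeries rk σ F - ∑ u with u < v ∧ rk u = rk v - k, headSeries rk σ F u) := by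
  ext i
  rw [headSeries, PowerSeries.coeff_mk, headCount_eq hv, map_sum, Nat.cast_sum]
  refine Finset.sum_congr rfl fun k _ => ?_
  rw [PowerSeries.coeff_X_pow_mul']
  split_ifs with hk
  · rw [map_sub, map_sum, fixedSeries, PowerSeries.coeff_mk,
      ← card_not_headBelow v (rk v - k) (i - k)]
    simp [headSeries]
  · simp

open Classical in
-- The forbidden continuations are moved to the left: each `u < v` is forbidden after exactly one
-- letter of `v`, the one with `k = rk v - rk u`.
theorem headSeries_add_sum (hrk : IsUniformRank rk) {v : P} (hv : σ v = v) :
    headSeries rk σ F v + ∑ u with u < v, PowerSeries.X ^ (rk v - rk u) * headSeries rk σ F u =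
      (∑ k ∈ Finset.Icc 1 (rk v), PowerSeries.X ^ k) * fixedSeries rk σ F := by
  have h : ∑ u with u < v, PowerSeries.X ^ (rk v - rk u) * headSeries rk σ F u =
      ∑ k ∈ Finset.Icc 1 (rk v), PowerSeries.X ^ k *
        ∑ u with u < v ∧ rk u = rk v - k, headSeries rk σ F u := by
    simp_rw [Finset.mul_sum, Finset.sum_filter]
    rw [Finset.sum_comm]
    refine Finset.sum_congr rfl fun u _ => ?_
    split_ifs with huv
    · have h1 := hrk.strictMono huv
      rw [Finset.sum_eq_single (rk v - rk u)]
      · rw [if_pos ⟨huv, by omega⟩]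
      · intro k hk hne
        rw [Finset.mem_Icc] at hk
        rw [if_neg]
        rintro ⟨-, h⟩
        omega
      · intro h
        rw [Finset.mem_Icc] at h
        omega
    · simp [huv]
  rw [h, headSeries_eq F hv, ← Finset.sum_add_distrib, Finset.sum_mul]
  refine Finset.sum_congr rfl fun k _ => ?_
  rw [mul_sub, sub_add_cancel]

theorem one_sub_X_mul_sum (r : ℕ) :
    (1 - PowerSeries.X) * ∑ k ∈ Finset.Icc 1 r, PowerSeries.X ^ k =
      PowerSeries.X * (1 - PowerSeries.X ^ r : PowerSeries F) := by
  induction r with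
  | zero => simp
  | succ r ih =>
    rw [Finset.sum_Icc_succ_top (by omega), mul_add, ih]
    ring

open Classical in
/-- The series of the words that begin with a letter of `v`, in terms of the solution of a
triangular system of equations. -/
theorem one_sub_X_mul_headSeries (hrk : IsUniformRank rk) (hσ : ∀ v, rk (σ v) = rk v)
    (γ : P → PowerSeries F) (hγ0 : ∀ v, σ v ≠ v → γ v = 0)
    (hγ : ∀ v, σ v = v → ∑ u with u ≤ v, PowerSeries.X ^ (rk v - rk u) * γ u = 1) (v : P) :
    (1 - PowerSeries.X) * headSeries rk σ F v =
      fixedSeries rk σ F * PowerSeries.X * (if rk v = 0 then 0 else γ v) := by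
  induction hn : rk v using Nat.strong_induction_on generalizing v with
  | _ n ih =>
    subst hn
    by_cases hv : σ v = v
    swap
    · rw [headSeries_of_ne F hv, hγ0 v hv]
      simp
    split_ifs with h0
    · rw [headSeries_eq F hv, h0]
      simp
    have h1 := headSeries_add_sum F hrk hv
    obtain ⟨o, hov, ho⟩ := hrk.exists_le_rank v 0 (by omega)
    have hofix : σ o = o := hrk.unique_zero ((hσ o).trans ho) ho
    have hmin : ∀ u, u ≤ o → u = o := by
      intro u hu
      have := hrk.strictMono.monotone hu
      exact hrk.unique_zero (by omega) ho
    have hγo : γ o = 1 := by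
      have := hγ o hofix
      rwa [show (Finset.univ.filter fun u => u ≤ o) = {o} by
        ext u; simpa using ⟨hmin u, fun h => h.le⟩, Finset.sum_singleton, Nat.sub_self, pow_zero,
        one_mul] at this
    have h2 : ∑ u with u ≤ v, PowerSeries.X ^ (rk v - rk u) * γ u =
        γ v + ∑ u with u < v, PowerSeries.X ^ (rk v - rk u) * γ u := by
      rw [show (Finset.univ.filter fun u => u ≤ v) =
        insert v (Finset.univ.filter fun u => u < v) by ext u; simp [le_iff_eq_or_lt],
        Finset.sum_insert (by simp), Nat.sub_self, pow_zero, one_mul]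
    -- The least element is split off: `γ` is `1` there although no normal word begins there. Its
    -- term `X ^ rk v` matches the one in the geometric sum `one_sub_X_mul_sum`.
    have h3 : ∑ u with u < v, PowerSeries.X ^ (rk v - rk u) * γ u =
        PowerSeries.X ^ rk v + ∑ u with u < v, PowerSeries.X ^ (rk v - rk u) *
          (if rk u = 0 then 0 else γ u) := by
      have hov' : o < v := hov.lt_of_ne (by rintro rfl; exact h0 ho)
      have hmem : o ∈ Finset.univ.filter fun u => u < v := by simpa using hov'
      rw [← Finset.add_sum_erase _ _ hmem, ← Finset.add_sum_erase _ (fun u =>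
        PowerSeries.X ^ (rk v - rk u) * (if rk u = 0 then 0 else γ u)) hmem, ho, hγo]
      simp only [if_true, mul_zero, zero_add, mul_one, Nat.sub_zero]
      congr 1
      refine Finset.sum_congr rfl fun u hu => ?_
      rw [if_neg fun h => (Finset.mem_erase.1 hu).1 (hrk.unique_zero h ho)]
    have h4 : (1 - PowerSeries.X) * ∑ u with u < v,
        PowerSeries.X ^ (rk v - rk u) * headSeries rk σ F u =
        fixedSeries rk σ F * PowerSeries.X * ∑ u with u < v, PowerSeries.X ^ (rk v - rk u) *
          (if rk u = 0 then 0 else γ u) := by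
      rw [Finset.mul_sum, Finset.mul_sum]
      refine Finset.sum_congr rfl fun u hu => ?_
      rw [mul_left_comm, ih (rk u) (hrk.strictMono (Finset.mem_filter.1 hu).2) u rfl]
      ring
    have h5 := hγ v hv
    rw [h2, h3] at h5
    have h6 := one_sub_X_mul_sum F (rk v)
    linear_combination (1 - PowerSeries.X) * h1 - h4 + fixedSeries rk σ F * h6 -
      fixedSeries rk σ F * PowerSeries.X * h5

open Classical in
-- Let $S$ be the series of all fixed words. Summing the head series, where $\gamma=1$ at the least
-- element is left out, gives $(1-z)S=(1-z)+zS(\sum_v\gamma(v)-1)$, that is,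
-- $S(1-z\sum_v\gamma(v))=1-z$.
theorem gradedTrace_eq (hrk : IsUniformRank rk) (hσ : ∀ v, rk (σ v) = rk v) [Nonempty P]
    (γ : P → PowerSeries F) (hγ0 : ∀ v, σ v ≠ v → γ v = 0)
    (hγ : ∀ v, σ v = v → ∑ u with u ≤ v, PowerSeries.X ^ (rk v - rk u) * γ u = 1) :
    gradedTrace F σ = (1 - PowerSeries.X) * (1 - PowerSeries.X * ∑ v, γ v)⁻¹ := by
  have h1 : gradedTrace F σ = fixedSeries rk σ F := by
    ext i
    rw [coeff_gradedTrace F hrk hσ, fixedSeries, PowerSeries.coeff_mk, ← Set.ncard_coe_finset]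
    congr 2
    ext W
    simp [mem_fixedWords, and_assoc]
  obtain ⟨o, -, ho⟩ := hrk.exists_le_rank (Classical.arbitrary P) 0 (Nat.zero_le _)
  have hofix : σ o = o := hrk.unique_zero ((hσ o).trans ho) ho
  have hγo : γ o = 1 := by
    have := hγ o hofix
    rwa [show (Finset.univ.filter fun u => u ≤ o) = {o} by
      ext u
      simp only [Finset.mem_filter, Finset.mem_univ, true_and, Finset.mem_singleton]
      refine ⟨fun hu => ?_, fun h => h.le⟩
      have := hrk.strictMono.monotone hu
      exact hrk.unique_zero (by omega) ho, Finset.sum_singleton, Nat.sub_self, pow_zero,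
      one_mul] at this
  have h2 : ∑ v, γ v = 1 + ∑ v, if rk v = 0 then 0 else γ v := by
    rw [← Finset.add_sum_erase _ _ (Finset.mem_univ o), ← Finset.add_sum_erase _ (fun v =>
      if rk v = 0 then 0 else γ v) (Finset.mem_univ o), hγo, if_pos ho, zero_add]
    congr 1
    refine Finset.sum_congr rfl fun u hu => ?_
    rw [if_neg fun h => (Finset.mem_erase.1 hu).1 (hrk.unique_zero h ho)]
  have h3 : (1 - PowerSeries.X) * fixedSeries rk σ F = (1 - PowerSeries.X) +
      fixedSeries rk σ F * PowerSeries.X * ∑ v, if rk v = 0 then 0 else γ v := by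
    conv_lhs => rw [fixedSeries_eq]
    rw [mul_add, mul_one, Finset.mul_sum, Finset.mul_sum]
    congr 1
    exact Finset.sum_congr rfl fun v _ => one_sub_X_mul_headSeries F hrk hσ γ hγ0 hγ v
  rw [h1, PowerSeries.eq_mul_inv_iff_mul_eq (by simp), h2]
  linear_combination h3

omit [Fintype P] [DecidableEq P] in
/-- Order automorphisms preserve the rank. -/
theorem IsUniformRank.rank_apply (hrk : IsUniformRank rk) (σ : P ≃o P) (v : P) :
    rk (σ v) = rk v := by
  induction hn : rk v using Nat.strong_induction_on generalizing v with
  | _ n ih =>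
    subst hn
    by_cases h0 : rk v = 0
    · by_contra h
      obtain ⟨y, hy⟩ := hrk.exists_covBy (y := σ v) (by omega)
      have h1 : σ.symm y ⋖ v := by
        rw [← apply_covBy_apply_iff σ, OrderIso.apply_symm_apply]
        exact hy
      have := hrk.covBy h1
      omega
    · obtain ⟨y, hy⟩ := hrk.exists_covBy h0
      have h1 := hrk.covBy hy
      have h2 := hrk.covBy ((apply_covBy_apply_iff σ).2 hy)
      have h3 := ih (rk y) (by omega) y rfl
      omega

end Counting

end SplittingAlg

/-! ### The poset of divisors and the cycles of the permutation -/

namespace SplittingAlg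

open ArithmeticFunction

section Divisors

variable {n : ℕ}

theorem FactorPoset.val_ne_zero (hn : n ≠ 0) (d : FactorPoset n) : d.val ≠ 0 :=
  ne_zero_of_dvd_ne_zero hn d.dvd

theorem FactorPoset.finite (hn : n ≠ 0) : Finite (FactorPoset n) := by
  refine Finite.of_injective (β := n.divisors) (fun d => ⟨d.val, ?_⟩) ?_
  · exact Nat.mem_divisors.2 ⟨d.dvd, hn⟩
  · intro a b h
    exact FactorPoset.ext (congrArg Subtype.val h)

/-- The rank of a factor: the number of its prime factors, with multiplicity. -/
def factorRank (d : FactorPoset n) : ℕ := cardFactors d.val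

theorem factorRank_strictMono (hn : n ≠ 0) : StrictMono (factorRank (n := n)) := by
  intro a b hab
  obtain ⟨c, hc⟩ : a.val ∣ b.val := hab.le
  have hb := b.val_ne_zero hn
  have ha := a.val_ne_zero hn
  have hc0 : c ≠ 0 := by rintro rfl; exact hb hc
  rw [factorRank, factorRank, hc, cardFactors_mul ha hc0]
  have : cardFactors c ≠ 0 := by
    rw [Ne, cardFactors_eq_zero_iff_eq_zero_or_one]
    rintro (rfl | rfl)
    · exact hc0 rfl
    · exact hab.ne (FactorPoset.ext (by rw [hc, mul_one]))
  omega

theorem exists_prime_of_covBy (hn : n ≠ 0) {x y : FactorPoset n} (h : x ⋖ y) :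
    ∃ p, p.Prime ∧ y.val = x.val * p := by
  obtain ⟨c, hc⟩ : x.val ∣ y.val := h.le
  have hx := x.val_ne_zero hn
  have hc1 : c ≠ 1 := by
    rintro rfl
    exact h.lt.ne (FactorPoset.ext (by rw [hc, mul_one]))
  obtain ⟨p, hp, e, he⟩ := Nat.exists_prime_and_dvd hc1
  refine ⟨p, hp, ?_⟩
  let z : FactorPoset n := ⟨x.val * p, (Dvd.intro e (by rw [hc, he, mul_assoc])).trans y.dvd⟩
  have hxz : x < z := by
    refine lt_of_le_of_ne (Dvd.intro p rfl : x.val ∣ x.val * p) ?_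
    intro h'
    have h1 : x.val = x.val * p := congrArg FactorPoset.val h'
    exact hp.one_lt.ne' (Nat.eq_of_mul_eq_mul_left (Nat.pos_of_ne_zero hx) (by omega))
  have hzy : z ≤ y := (Dvd.intro e (by rw [hc, he, mul_assoc]) : x.val * p ∣ y.val)
  rcases hzy.eq_or_lt with h' | h'
  · exact (congrArg FactorPoset.val h').symm
  · exact absurd h' (h.2 hxz)

theorem covBy_of_mul_prime (hn : n ≠ 0) {x y : FactorPoset n} {p : ℕ} (hp : p.Prime)
    (h : y.val = x.val * p) : x ⋖ y := by
  have hr : factorRank y = factorRank x + 1 := by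
    rw [factorRank, factorRank, h, cardFactors_mul (x.val_ne_zero hn) hp.ne_zero,
      cardFactors_apply_prime hp]
  refine ⟨lt_of_le_of_ne (Dvd.intro p h.symm : x.val ∣ y.val) (by rintro rfl; omega), ?_⟩
  intro z h1 h2
  have := factorRank_strictMono hn h1
  have := factorRank_strictMono hn h2
  omega

theorem isUniformRank_factorRank (hn : n ≠ 0) : IsUniformRank (factorRank (n := n)) where
  strictMono := factorRank_strictMono hn
  covBy {x y} h := by
    obtain ⟨p, hp, h⟩ := exists_prime_of_covBy hn h
    rw [factorRank, factorRank, h, cardFactors_mul (x.val_ne_zero hn) hp.ne_zero,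
      cardFactors_apply_prime hp]
  unique_zero {x y} hx hy := by
    rw [factorRank, cardFactors_eq_zero_iff_eq_zero_or_one] at hx hy
    have h1 := x.val_ne_zero hn
    have h2 := y.val_ne_zero hn
    exact FactorPoset.ext (by omega)
  exists_covBy {y} hy := by
    rw [factorRank, Ne, cardFactors_eq_zero_iff_eq_zero_or_one, not_or] at hy
    obtain ⟨p, hp, c, hc⟩ := Nat.exists_prime_and_dvd hy.2
    exact ⟨⟨c, (Dvd.intro_left p hc.symm).trans y.dvd⟩,
      covBy_of_mul_prime hn hp (hc.trans (mul_comm p c))⟩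
  diamond {x x' y} hx hx' hne := by
    obtain ⟨p, hp, h⟩ := exists_prime_of_covBy hn hx
    obtain ⟨q, hq, h'⟩ := exists_prime_of_covBy hn hx'
    have hpq : p ≠ q := by
      rintro rfl
      exact hne (FactorPoset.ext (Nat.eq_of_mul_eq_mul_right hp.pos (h.symm.trans h')))
    -- With `x = y / p` and `x' = y / q` for distinct primes, the common lower cover is `y / (p *
    -- q)`.
    have hqx : q ∣ x.val := by
      have h1 : q ∣ x.val * p := Dvd.intro_left x'.val (h'.symm.trans h)
      exact (Nat.Coprime.dvd_mul_right ((Nat.coprime_primes hq hp).2 hpq.symm)).1 h1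
    obtain ⟨z, hz⟩ := hqx
    refine ⟨⟨z, (Dvd.intro_left q hz.symm).trans x.dvd⟩,
      covBy_of_mul_prime hn hq (hz.trans (mul_comm q z)), covBy_of_mul_prime hn hp ?_⟩
    apply Nat.eq_of_mul_eq_mul_right hq.pos
    refine h'.symm.trans (h.trans ?_)
    change x.val * p = z * p * q
    rw [hz]
    ring

theorem factorRank_eq_sum (hn : n ≠ 0) (d : FactorPoset n) :
    factorRank d = ∑ p : PrimeDivisor n, d.val.factorization p := by
  rw [factorRank, cardFactors_eq_sum_factorization, Finsupp.sum,
    Finset.sum_coe_sort n.primeFactors (fun p => d.val.factorization p)]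
  refine Finset.sum_subset ?_ ?_
  · rw [Nat.support_factorization]
    exact Nat.primeFactors_mono d.dvd hn
  · intro p _ hp
    exact Finsupp.notMem_support_iff.1 hp

theorem FactorPoset.le_iff (hn : n ≠ 0) (d e : FactorPoset n) :
    d ≤ e ↔ ∀ p : PrimeDivisor n, d.val.factorization p ≤ e.val.factorization p := by
  change d.val ∣ e.val ↔ _
  rw [← Nat.factorization_le_iff_dvd (d.val_ne_zero hn) (e.val_ne_zero hn)]
  constructor
  · intro h p
    exact h p
  · intro h p
    by_cases hp : p ∈ n.primeFactors
    · exact h ⟨p, hp⟩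
    · rw [factorization_eq_zero_of_dvd hn d.dvd hp]
      exact Nat.zero_le _

theorem FactorPoset.ext_factorization (hn : n ≠ 0) {d e : FactorPoset n}
    (h : ∀ p : PrimeDivisor n, d.val.factorization p = e.val.factorization p) : d = e :=
  le_antisymm ((FactorPoset.le_iff hn d e).2 fun p => (h p).le)
    ((FactorPoset.le_iff hn e d).2 fun p => (h p).ge)

section Shuffle

variable (hn : n ≠ 0) (τ : Equiv.Perm (PrimeDivisor n))
  (hτ : ∀ p, n.factorization (τ p) = n.factorization p)

theorem primeShuffle_eq_iff (d : FactorPoset n) : primeShuffle hn τ hτ d = d ↔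
    ∀ p, d.val.factorization (τ p) = d.val.factorization p := by
  have h : ∀ p, (primeShuffle hn τ hτ d).val.factorization (τ p) = d.val.factorization p :=
    fun p => factorization_shuffleNat τ d.val p
  constructor
  · intro h1 p
    rw [← h p, h1]
  · intro h1
    refine FactorPoset.ext_factorization hn fun q => ?_
    obtain ⟨p, rfl⟩ := τ.surjective q
    rw [h p, h1 p]

/-- The cycle of a prime. -/
abbrev cycleOf (p : PrimeDivisor n) : PrimeCycle τ :=
  Quotient.mk (Equiv.Perm.SameCycle.setoid τ) p

/-- The multiplicity of some prime of the cycle `c` in `d`. -/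
noncomputable def cycleExp (d : FactorPoset n) (c : PrimeCycle τ) : ℕ :=
  d.val.factorization (Quotient.out c : PrimeDivisor n)

variable {τ} in
theorem cycleExp_cycleOf {d : FactorPoset n}
    (hd : ∀ p, d.val.factorization (τ p) = d.val.factorization p) (p : PrimeDivisor n) :
    cycleExp τ d (cycleOf τ p) = d.val.factorization p := by
  have h : Equiv.Perm.SameCycle τ (Quotient.out (cycleOf τ p)) p :=
    Quotient.mk_out (s := Equiv.Perm.SameCycle.setoid τ) p
  obtain ⟨k, -, -, hk⟩ := Equiv.Perm.SameCycle.exists_pow_eq τ h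
  have h1 : ∀ m : ℕ, ∀ q, d.val.factorization ((τ ^ m) q : PrimeDivisor n) =
      d.val.factorization q := by
    intro m q
    induction m with
    | zero => rfl
    | succ m ih => rw [pow_succ', Equiv.Perm.mul_apply, hd, ih]
  rw [cycleExp, ← h1 k, hk]

/-- The factor with given exponents along the cycles. -/
noncomputable def cycleNat (b : PrimeCycle τ → ℕ) : ℕ :=
  ∏ p : PrimeDivisor n, (p : ℕ) ^ b (cycleOf τ p)

theorem cycleNat_ne_zero (b : PrimeCycle τ → ℕ) : cycleNat τ b ≠ 0 :=
  Finset.prod_ne_zero_iff.2 fun p _ => pow_ne_zero _ (Nat.prime_of_mem_primeFactors p.2).ne_zero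

theorem factorization_cycleNat (b : PrimeCycle τ → ℕ) (q : PrimeDivisor n) :
    (cycleNat τ b).factorization q = b (cycleOf τ q) := by
  unfold cycleNat
  rw [Nat.factorization_prod fun p _ =>
    pow_ne_zero _ (Nat.prime_of_mem_primeFactors p.2).ne_zero]
  rw [Finsupp.finsetSum_apply, Finset.sum_eq_single q]
  · rw [(Nat.prime_of_mem_primeFactors q.2).factorization_pow, Finsupp.single_eq_same]
  · intro p _ hp
    rw [(Nat.prime_of_mem_primeFactors p.2).factorization_pow, Finsupp.single_eq_of_ne]
    exact fun h => hp (Subtype.ext h.symm)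
  · simp

theorem factorization_cycleNat_of_notMem (b : PrimeCycle τ → ℕ) (q : ℕ)
    (hq : q ∉ n.primeFactors) : (cycleNat τ b).factorization q = 0 := by
  unfold cycleNat
  rw [Nat.factorization_prod fun p _ =>
    pow_ne_zero _ (Nat.prime_of_mem_primeFactors p.2).ne_zero]
  rw [Finsupp.finsetSum_apply]
  refine Finset.sum_eq_zero fun p _ => ?_
  rw [(Nat.prime_of_mem_primeFactors p.2).factorization_pow, Finsupp.single_eq_of_ne]
  rintro rfl
  exact hq p.2

theorem cycleOf_apply (p : PrimeDivisor n) : cycleOf τ (τ p) = cycleOf τ p := by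
  refine Quotient.sound ?_
  change Equiv.Perm.SameCycle τ (τ p) p
  exact Equiv.Perm.sameCycle_apply_left.2 (Equiv.Perm.SameCycle.refl τ p)

open Classical in
/-- Sums over the fixed factors below a fixed factor, as products over the cycles. -/
theorem sum_fixed_le [Fintype (FactorPoset n)] {R : Type*} [CommSemiring R] {v : FactorPoset n}
    (hv : primeShuffle hn τ hτ v = v) (f : PrimeCycle τ → ℕ → R) :
    ∑ u with u ≤ v ∧ primeShuffle hn τ hτ u = u, ∏ c, f c (cycleExp τ u c) =
      ∏ c, ∑ b ∈ Finset.range (cycleExp τ v c + 1), f c b := by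
  rw [Finset.prod_univ_sum]
  have hv' := (primeShuffle_eq_iff hn τ hτ v).1 hv
  refine Finset.sum_bij' (fun u _ => cycleExp τ u)
    (fun b hb => ⟨cycleNat τ b, ?_⟩) ?_ ?_ ?_ ?_ ?_
  · refine Dvd.dvd.trans ?_ v.dvd
    rw [← Nat.factorization_le_iff_dvd (cycleNat_ne_zero τ b) (v.val_ne_zero hn)]
    intro q
    by_cases hq : q ∈ n.primeFactors
    · rw [factorization_cycleNat τ b ⟨q, hq⟩, ← cycleExp_cycleOf hv' ⟨q, hq⟩]
      have := Fintype.mem_piFinset.1 hb (cycleOf τ ⟨q, hq⟩)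
      rw [Finset.mem_range] at this
      omega
    · rw [factorization_cycleNat_of_notMem τ b q hq]
      exact Nat.zero_le _
  · intro u hu
    obtain ⟨h1, -⟩ := (Finset.mem_filter.1 hu).2
    rw [Fintype.mem_piFinset]
    intro c
    rw [Finset.mem_range, Nat.lt_succ_iff]
    exact (FactorPoset.le_iff hn u v).1 h1 _
  · intro b hb
    refine Finset.mem_filter.2 ⟨Finset.mem_univ _, ?_, ?_⟩
    · rw [FactorPoset.le_iff hn]
      intro q
      rw [factorization_cycleNat τ b q, ← cycleExp_cycleOf hv' q]
      have := Fintype.mem_piFinset.1 hb (cycleOf τ q)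
      rw [Finset.mem_range] at this
      omega
    · rw [primeShuffle_eq_iff]
      intro p
      rw [factorization_cycleNat, factorization_cycleNat, cycleOf_apply]
  · intro u hu
    obtain ⟨-, h2⟩ := (Finset.mem_filter.1 hu).2
    refine FactorPoset.ext_factorization hn fun p => ?_
    rw [factorization_cycleNat τ _ p, cycleExp_cycleOf ((primeShuffle_eq_iff hn τ hτ u).1 h2)]
  · intro b hb
    funext c
    rw [cycleExp, factorization_cycleNat, cycleOf, Quotient.out_eq]
  · intro u hu
    rfl

theorem factorRank_eq_sum_cycles {d : FactorPoset n} (hd : primeShuffle hn τ hτ d = d) :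
    factorRank d = ∑ c, cycleLength τ c * cycleExp τ d c := by
  classical
  rw [factorRank_eq_sum hn, ← Finset.sum_fiberwise (g := cycleOf τ)]
  refine Finset.sum_congr rfl fun c _ => ?_
  have h : ∀ p ∈ Finset.univ.filter (fun p => cycleOf τ p = c),
      d.val.factorization p = cycleExp τ d c := by
    intro p hp
    rw [← (Finset.mem_filter.1 hp).2, cycleExp_cycleOf ((primeShuffle_eq_iff hn τ hτ d).1 hd)]
  rw [Finset.sum_congr rfl h, Finset.sum_const, smul_eq_mul, cycleLength, Nat.card_eq_fintype_card,
    Fintype.card_subtype]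

end Shuffle

/-- The equation for `γ` on a single chain: $x^s+(1-x)(1+x+\dots+x^{s-1})=1$. -/
theorem sum_range_geom {R : Type*} [CommRing R] (x : R) (s : ℕ) :
    ∑ b ∈ Finset.range (s + 1), x ^ (s - b) * (if b = 0 then 1 else 1 - x) = 1 := by
  rw [Finset.sum_range_succ', if_pos rfl, mul_one, Nat.sub_zero]
  have : ∀ s : ℕ, ∑ b ∈ Finset.range s, x ^ (s - (b + 1)) * (1 - x) = 1 - x ^ s := by
    intro s
    induction s with
    | zero => simp
    | succ s ih =>
      rw [Finset.sum_range_succ', Nat.zero_add, Nat.add_sub_cancel]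
      simp only [Nat.add_sub_add_right]
      rw [ih]
      ring
  simp only [Nat.add_eq_zero_iff, one_ne_zero, and_false, if_false]
  rw [this]
  ring

end Divisors

end SplittingAlg

/-- A divisor is fixed exactly when its exponents are constant on cycles, and its rank is then the
sum of the exponents weighted by the cycle lengths. Both the equations for `γ` and its total
therefore factor over the cycles. -/
theorem theorem6p2 (F : Type*) [Field F] (n : ℕ) (hn : n ≠ 0)
    (τ : Equiv.Perm (SplittingAlg.PrimeDivisor n))
    (hτ : ∀ p, n.factorization (τ p) = n.factorization p) :
    SplittingAlg.gradedTrace F (SplittingAlg.primeShuffle hn τ hτ) =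
      (1 - PowerSeries.X) *
        (1 - PowerSeries.X *
          ∏ c : SplittingAlg.PrimeCycle τ,
            (1 + (SplittingAlg.cycleMult τ hτ c : PowerSeries F) *
              (1 - PowerSeries.X ^ SplittingAlg.cycleLength τ c)))⁻¹ := by
  classical
  have : Finite (SplittingAlg.FactorPoset n) := SplittingAlg.FactorPoset.finite hn
  have : Fintype (SplittingAlg.FactorPoset n) := Fintype.ofFinite _
  have : Nonempty (SplittingAlg.FactorPoset n) := ⟨⟨n, dvd_rfl⟩⟩
  have hrk := SplittingAlg.isUniformRank_factorRank hn
  set σ := SplittingAlg.primeShuffle hn τ hτ with hσ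
  let f : SplittingAlg.PrimeCycle τ → ℕ → PowerSeries F := fun c b =>
    if b = 0 then 1 else 1 - PowerSeries.X ^ SplittingAlg.cycleLength τ c
  let γ : SplittingAlg.FactorPoset n → PowerSeries F := fun u =>
    if σ u = u then ∏ c, f c (SplittingAlg.cycleExp τ u c) else 0
  have h := SplittingAlg.gradedTrace_eq F (σ := σ) hrk (hrk.rank_apply σ) γ
    (fun v hv => by simp [γ, hv]) ?_
  · rw [h]
    congr 4
    have htop : σ (⟨n, dvd_rfl⟩ : SplittingAlg.FactorPoset n) = ⟨n, dvd_rfl⟩ :=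
      (SplittingAlg.primeShuffle_eq_iff hn τ hτ _).2 hτ
    have h1 := SplittingAlg.sum_fixed_le hn τ hτ htop f
    have h2 : ∀ u : SplittingAlg.FactorPoset n, u ≤ ⟨n, dvd_rfl⟩ := fun u => u.dvd
    simp only [h2, true_and] at h1
    rw [← Finset.sum_filter, h1]
    refine Finset.prod_congr rfl fun c _ => ?_
    have h3 : SplittingAlg.cycleExp τ (⟨n, dvd_rfl⟩ : SplittingAlg.FactorPoset n) c =
        SplittingAlg.cycleMult τ hτ c := by
      conv_rhs => rw [← Quotient.out_eq c]
      rfl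
    -- Exponent `0` contributes `1`, and each of the remaining `cycleMult` exponents contributes the
    -- same factor.
    rw [h3, Finset.sum_range_succ']
    simp [f, add_comm, mul_sub]
  · intro v hv
    -- The weight `X ^ (rk v - rk u)` is distributed over the cycles, so that each cycle yields the
    -- chain identity `sum_range_geom` in `X ^ cycleLength τ c`.
    have h1 := SplittingAlg.sum_fixed_le hn τ hτ hv fun c b =>
      PowerSeries.X ^ (SplittingAlg.cycleLength τ c * (SplittingAlg.cycleExp τ v c - b)) * f c b
    have h2 : ∀ c, ∑ b ∈ Finset.range (SplittingAlg.cycleExp τ v c + 1),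
        PowerSeries.X ^ (SplittingAlg.cycleLength τ c * (SplittingAlg.cycleExp τ v c - b)) *
          f c b = 1 := by
      intro c
      simp only [pow_mul, f]
      exact SplittingAlg.sum_range_geom _ _
    rw [Finset.prod_congr rfl fun c _ => h2 c, Finset.prod_const_one] at h1
    rw [← h1, ← Finset.filter_filter, Finset.sum_filter (fun u => σ u = u)]
    refine Finset.sum_congr rfl fun u hu => ?_
    by_cases hu' : σ u = u
    · have h3 : ∀ c, SplittingAlg.cycleExp τ u c ≤ SplittingAlg.cycleExp τ v c := fun c =>
        (SplittingAlg.FactorPoset.le_iff hn u v).1 (Finset.mem_filter.1 hu).2 _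
      have h4 : SplittingAlg.factorRank v - SplittingAlg.factorRank u =
          ∑ c, SplittingAlg.cycleLength τ c *
            (SplittingAlg.cycleExp τ v c - SplittingAlg.cycleExp τ u c) := by
        rw [SplittingAlg.factorRank_eq_sum_cycles hn τ hτ hv,
          SplittingAlg.factorRank_eq_sum_cycles hn τ hτ hu',
          ← Finset.sum_tsub_distrib _ fun c _ => Nat.mul_le_mul_left _ (h3 c)]
        simp only [Nat.mul_sub]
      rw [if_pos hu', Finset.prod_mul_distrib, Finset.prod_pow_eq_pow_sum, h4]
      simp only [γ, if_pos hu']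
    · simp [γ, hu']
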